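/- Let $\omega$ be a free ultrafilter on $\mathbb{N}$. For a sequence $(n_k)_k$ of positive integers with $n_k\to\infty$, let $\Pi_{k\to\omega}P_{n_k}$ be the ultraproduct of the groups $P_{n_k}$ of $n_k\times n_k$ permutation matrices with respect to the normalised Hamming distance, and $\Pi_{k\to\omega}D_{n_k}$ the ultraproduct of the diagonal algebras with respect to the normalised trace $Tr$. Its projections $p=\Pi_{k\to\omega}p_k$ are given by sequences of subsets $S_k\subset\{1,\dots,n_k\}$, and $Tr(p)=\lim_{k\to\omega}|S_k|/n_k$. A *sofic representation* of a group $G$ is a homomorphism $\Theta:G\to\Pi_{k\to\omega}P_{n_k}$ (for some such $(n_k)_k$) with $Tr(\Theta(g))=0$ for all $g\neq e$. Two sofic representations $\Theta:G\to\Pi_{k\to\omega}P_{n_k}$ and $\Phi:G\to\Pi_{k\to\omega}P_{m_k}$ are *equivalent* if there are positive integers $r_k,t_k$ with $n_kr_k=m_kt_k$ for all $k$ such that $\Theta\otimes Id_{r_k}$ and $\Phi\otimes Id_{t_k}$ are conjugate by an element of $\Pi_{k\to\omega}P_{n_kr_k}$. The set of classes $[\Theta]$ is $Sof(G,P^\omega)$.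 For $\lambda\in[0,1]$, the convex combination $\lambda[\Theta_1]+(1-\lambda)[\Theta_2]$ is the class of $(\Theta_1\otimes Id_{r_k})\oplus(\Theta_2\otimes Id_{t_k})$, where the positive integers $r_k,t_k$ are such that the first summand occupies, in the limit $k\to\omega$, the proportion $\lambda$ of the dimension. A point $z$ is *extreme* if $z=\lambda x+(1-\lambda)y$ with $0<\lambda<1$ implies $x=y=z$. A *face* is a nonempty convex set $F$ such that $\lambda x+(1-\lambda)y\in F$ with $0<\lambda<1$ implies $x,y\in F$. A *cutting projection* of $\Theta$ is a nonzero projection $p\in\Pi_{k\to\omega}D_{n_kr_k}$, for some positive integers $r_k$, commuting with $\Theta\otimes Id_{r_k}$; the *cut* $\Theta_p$ is the sofic representation obtained by restricting $\Theta\otimes Id_{r_k}$ to the support of $p$; its class $[\Theta_p]$ is well defined. Put $F_{[\Theta]}=\{[\Theta_p]: p\text{ a cutting projection of }\Theta\}$. **Theorem.** Let $G$ be a countable group, let $(x_i)_{i\in\mathbb{N}}$ be a sequence of pairwise distinct extreme points of $Sof(G,P^\omega)$, and let $\lambda_i>0$ be such that $\sum_i\lambda_i=1$. 1. There exist a sofic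 representation $\Psi:G\to\Pi_{k\to\omega}P_{n_k}$ and pairwise orthogonal cutting projections $p_i\in\Pi_{k\to\omega}D_{n_k}$ of $\Psi$ such that $Tr(p_i)=\lambda_i$, $\sum_ip_i=Id$ and $[\Psi_{p_i}]=x_i$ for all $i$ (an infinite convex combination of the $x_i$). 2. For all $\Psi$ and $(p_i)_i$ as in 1, put $q_j=\sum_{i\geq j}p_i$. Then each cut $\Psi_{q_j}$ exists, the sets $F_j=F_{[\Psi_{q_j}]}$ are faces of $Sof(G,P^\omega)$, they form a strictly decreasing chain $F_0\supsetneq F_1\supsetneq F_2\supsetneq\cdots$, and $\bigcap_jF_j=\emptyset$. -/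

import Mathlib

open Filter Topology

namespace SoficSpace

noncomputable section

/-- Normalised counting measure of a subset of a finite set. -/
def density {X : Type} (S : Set X) : ℝ := (S.ncard : ℝ) / (Nat.card X : ℝ)

theorem density_nonneg {X : Type} (S : Set X) : 0 ≤ density S := by
  unfold density; positivity

theorem density_mono {X : Type} [Finite X] {S T : Set X} (h : S ⊆ T) : density S ≤ density T := by
  unfold density
  have := Set.ncard_le_ncard h (Set.toFinite T)
  gcongr

theorem density_union_le {X : Type} (S T : Set X) :
    density (S ∪ T) ≤ density S + density T := by
  unfold density
  rw [← add_div]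
  have : ((S ∪ T).ncard : ℝ) ≤ S.ncard + T.ncard := by exact_mod_cast Set.ncard_union_le S T
  gcongr

theorem density_preimage {X Y : Type} (e : X ≃ Y) (S : Set Y) :
    density (e ⁻¹' S) = density S := by
  unfold density
  rw [Nat.card_congr e, ← Set.ncard_image_of_injective _ e.injective, e.image_preimage]

theorem density_preimage_fst_le {X Y : Type} [Finite X] [Finite Y] (S : Set X) :
    density (Prod.fst ⁻¹' S : Set (X × Y)) ≤ density S := by
  unfold density
  have h : (Prod.fst ⁻¹' S : Set (X × Y)) = S ×ˢ (Set.univ : Set Y) := by ext; simp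
  rw [h, Set.ncard_prod, Set.ncard_univ, Nat.card_prod]
  push_cast
  rcases Nat.eq_zero_or_pos (Nat.card Y) with h0 | h0
  · simp only [h0, Nat.cast_zero, mul_zero, div_zero]; positivity
  · rw [mul_div_mul_right _ _ (by positivity)]

theorem density_le_one {X : Type} [Finite X] (S : Set X) : density S ≤ 1 := by
  unfold density
  apply div_le_one_of_le₀ _ (by positivity)
  exact_mod_cast Set.ncard_le_card S

/-- The sequence of subsets `S k` is negligible in the ultraproduct of the finite probability
spaces `X k` along `ω`. -/
def IsNull (ω : Ultrafilter ℕ) {X : ℕ → Type} (S : ∀ k, Set (X k)) : Prop :=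
  Tendsto (fun k => density (S k)) (ω : Filter ℕ) (𝓝 0)

/-- The trace `lim_{k → ω} |S k| / |X k|` of the projection of `∏_{k → ω} D(X k)` given by the
subsets `S k`. -/
def tr (ω : Ultrafilter ℕ) {X : ℕ → Type} (S : ∀ k, Set (X k)) : ℝ :=
  limUnder (ω : Filter ℕ) (fun k => density (S k))

theorem tendsto_tr (ω : Ultrafilter ℕ) {X : ℕ → Type} [∀ k, Finite (X k)] (S : ∀ k, Set (X k)) :
    Tendsto (fun k => density (S k)) (ω : Filter ℕ) (𝓝 (tr ω S)) := by
  apply tendsto_nhds_limUnder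
  have hc : IsCompact (Set.Icc (0 : ℝ) 1) := isCompact_Icc
  obtain ⟨x, -, hx⟩ := hc.ultrafilter_le_nhds (ω.map fun k => density (S k)) (by
    rw [le_principal_iff, Ultrafilter.mem_coe, Ultrafilter.mem_map]
    exact Filter.univ_mem' fun k => ⟨density_nonneg (S k), density_le_one (S k)⟩)
  exact ⟨x, hx⟩

theorem IsNull.mono {ω : Ultrafilter ℕ} {X : ℕ → Type} [∀ k, Finite (X k)]
    {S T : ∀ k, Set (X k)} (hT : IsNull ω T) (h : ∀ k, S k ⊆ T k) : IsNull ω S :=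
  squeeze_zero (fun _ => density_nonneg _) (fun k => density_mono (h k)) hT

theorem IsNull.union {ω : Ultrafilter ℕ} {X : ℕ → Type}
    {S T : ∀ k, Set (X k)} (hS : IsNull ω S) (hT : IsNull ω T) :
    IsNull ω (fun k => S k ∪ T k) :=
  squeeze_zero (fun _ => density_nonneg _) (fun k => density_union_le (S k) (T k))
    (by simpa using Tendsto.add hS hT)

theorem IsNull.preimage {ω : Ultrafilter ℕ} {X Y : ℕ → Type} (e : ∀ k, X k ≃ Y k)
    {S : ∀ k, Set (Y k)} (hS : IsNull ω S) : IsNull ω (fun k => e k ⁻¹' S k) := by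
  simpa only [IsNull, density_preimage] using hS

theorem IsNull.preimage_fst {ω : Ultrafilter ℕ} {X Y : ℕ → Type} [∀ k, Finite (X k)]
    [∀ k, Finite (Y k)] {S : ∀ k, Set (X k)} (hS : IsNull ω S) :
    IsNull ω (fun k => (Prod.fst ⁻¹' S k : Set (X k × Y k))) :=
  squeeze_zero (fun _ => density_nonneg _) (fun k => density_preimage_fst_le (S k)) hS

/-- Sequences of permutations whose normalised Hamming distance to the identity tends to `0`
along `ω`. -/
def nullSubgroup (ω : Ultrafilter ℕ) (X : ℕ → Type) [∀ k, Finite (X k)] :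
    Subgroup (∀ k, Equiv.Perm (X k)) where
  carrier := {σ | IsNull ω (fun k => {x | σ k x ≠ x})}
  one_mem' := by simp [IsNull, density]
  mul_mem' := by
    intro σ τ hσ hτ
    refine IsNull.mono ((IsNull.preimage τ hσ).union hτ) fun k x hx => ?_
    by_contra hc
    simp only [Set.mem_union, Set.mem_preimage, Set.mem_ofPred_eq, not_or, not_not] at hc
    apply hx
    change σ k (τ k x) = x
    rw [hc.1, hc.2]
  inv_mem' := by
    intro σ hσ
    refine IsNull.mono hσ fun k x hx => ?_
    intro h
    apply hx
    exact (Equiv.symm_apply_eq (σ k)).2 h.symm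

instance nullSubgroup_normal (ω : Ultrafilter ℕ) (X : ℕ → Type) [∀ k, Finite (X k)] :
    (nullSubgroup ω X).Normal where
  conj_mem := by
    intro σ hσ τ
    refine IsNull.mono (IsNull.preimage (fun k => (τ k)⁻¹) hσ) fun k x hx => ?_
    intro h
    apply hx
    change τ k (σ k ((τ k)⁻¹ x)) = x
    rw [h]
    exact (τ k).apply_symm_apply x

/-- The ultraproduct `∏_{k → ω} Sym(X k)` with respect to the normalised Hamming distances;
for `X k = Fin (n k)` this is the universal sofic group `∏_{k → ω} P_{n k}`. -/
abbrev UProd (ω : Ultrafilter ℕ) (X : ℕ → Type) [∀ k, Finite (X k)] : Type :=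
  (∀ k, Equiv.Perm (X k)) ⧸ nullSubgroup ω X

/-- The element of the ultraproduct represented by a sequence of permutations. -/
def UProd.mk (ω : Ultrafilter ℕ) {X : ℕ → Type} [∀ k, Finite (X k)]
    (σ : ∀ k, Equiv.Perm (X k)) : UProd ω X := QuotientGroup.mk' (nullSubgroup ω X) σ

theorem UProd.mk_eq_iff {ω : Ultrafilter ℕ} {X : ℕ → Type} [∀ k, Finite (X k)]
    {σ τ : ∀ k, Equiv.Perm (X k)} :
    UProd.mk ω σ = UProd.mk ω τ ↔ IsNull ω (fun k => {x | σ k x ≠ τ k x}) := by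
  unfold UProd.mk
  rw [QuotientGroup.mk'_apply, QuotientGroup.mk'_apply, QuotientGroup.eq]
  have : ∀ k, {x | (σ⁻¹ * τ) k x ≠ x} = {x | σ k x ≠ τ k x} := by
    intro k
    ext x
    refine not_congr ?_
    change (σ k).symm (τ k x) = x ↔ _
    rw [Equiv.symm_apply_eq, eq_comm]
  change IsNull ω _ ↔ _
  simp only [this]

theorem UProd.exists_rep {ω : Ultrafilter ℕ} {X : ℕ → Type} [∀ k, Finite (X k)]
    (a : UProd ω X) : ∃ σ, UProd.mk ω σ = a :=
  QuotientGroup.mk'_surjective _ a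

/-- The homomorphism of ultraproducts induced by a sequence of homomorphisms that do not increase
the normalised Hamming distance. -/
def UProd.map (ω : Ultrafilter ℕ) {X Y : ℕ → Type} [∀ k, Finite (X k)] [∀ k, Finite (Y k)]
    (f : ∀ k, Equiv.Perm (X k) →* Equiv.Perm (Y k))
    (hf : ∀ k σ, density {y | f k σ y ≠ y} ≤ density {x | σ x ≠ x}) :
    UProd ω X →* UProd ω Y :=
  QuotientGroup.map (nullSubgroup ω X) (nullSubgroup ω Y)
    (MonoidHom.mk' (fun σ k => f k (σ k)) (by intro a b; ext; simp))
    (fun σ hσ => squeeze_zero (fun _ => density_nonneg _) (fun k => hf k (σ k)) hσ)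

theorem UProd.map_mk (ω : Ultrafilter ℕ) {X Y : ℕ → Type} [∀ k, Finite (X k)] [∀ k, Finite (Y k)]
    (f : ∀ k, Equiv.Perm (X k) →* Equiv.Perm (Y k))
    (hf : ∀ k σ, density {y | f k σ y ≠ y} ≤ density {x | σ x ≠ x})
    (σ : ∀ k, Equiv.Perm (X k)) :
    UProd.map ω f hf (UProd.mk ω σ) = UProd.mk ω (fun k => f k (σ k)) := rfl

/-- `σ ↦ σ ⊗ Id_r` on permutations. -/
def ampPerm (X : Type) (r : ℕ) : Equiv.Perm X →* Equiv.Perm (X × Fin r) :=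
  MonoidHom.mk' (fun σ => Equiv.prodCongr σ (Equiv.refl (Fin r))) (by intro a b; ext <;> rfl)

/-- The amplification `a ↦ a ⊗ Id_{r k}` on ultraproducts. -/
def amp (ω : Ultrafilter ℕ) (X : ℕ → Type) [∀ k, Finite (X k)] (r : ℕ → ℕ) :
    UProd ω X →* UProd ω (fun k => X k × Fin (r k)) :=
  UProd.map ω (fun k => ampPerm (X k) (r k)) (by
    intro k σ
    refine le_trans (density_mono ?_) (density_preimage_fst_le (Y := Fin (r k)) {x | σ x ≠ x})
    rintro ⟨x, i⟩ h h'
    exact h (Prod.ext h' rfl))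

/-- The isomorphism of ultraproducts induced by bijections `u k : X k ≃ Y k`; it sends the class
of `σ` to that of `u σ u⁻¹`. -/
def conj (ω : Ultrafilter ℕ) {X Y : ℕ → Type} [∀ k, Finite (X k)] [∀ k, Finite (Y k)]
    (u : ∀ k, X k ≃ Y k) : UProd ω X →* UProd ω Y :=
  UProd.map ω (fun k => ((u k).permCongrHom : Equiv.Perm (X k) →* Equiv.Perm (Y k))) (by
    intro k σ
    refine le_trans (density_mono ?_) (density_preimage (u k).symm {x | σ x ≠ x}).le
    intro y h h'
    apply h
    have h'' : σ ((u k).symm y) = (u k).symm y := h'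
    simp [Equiv.permCongrHom, Equiv.permCongr_apply, h''])

/-- Embedding of `Sym(X)` in `Sym(X ⊔ Y)`, acting trivially on `Y`. -/
def inlPerm (X Y : Type) : Equiv.Perm X →* Equiv.Perm (X ⊕ Y) :=
  (Equiv.Perm.sumCongrHom X Y).comp (MonoidHom.inl _ _)

/-- Embedding of `Sym(Y)` in `Sym(X ⊔ Y)`, acting trivially on `X`. -/
def inrPerm (X Y : Type) : Equiv.Perm Y →* Equiv.Perm (X ⊕ Y) :=
  (Equiv.Perm.sumCongrHom X Y).comp (MonoidHom.inr _ _)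

theorem density_image_le {X Y : Type} [Finite X] [Finite Y] (f : X → Y)
    (hf : Function.Injective f) (S : Set X) : density (f '' S) ≤ density S := by
  unfold density
  rw [Set.ncard_image_of_injective _ hf]
  rcases Nat.eq_zero_or_pos (Nat.card X) with h0 | h0
  · have : IsEmpty X := (Nat.card_eq_zero.mp h0).resolve_right (not_infinite_iff_finite.mpr ‹_›)
    simp [Set.eq_empty_of_isEmpty S]
  · have := Nat.card_le_card_of_injective f hf
    gcongr

/-- `a ↦ a ⊕ Id`. -/
def inlU (ω : Ultrafilter ℕ) (X Y : ℕ → Type) [∀ k, Finite (X k)] [∀ k, Finite (Y k)] :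
    UProd ω X →* UProd ω (fun k => X k ⊕ Y k) :=
  UProd.map ω (fun k => inlPerm (X k) (Y k)) (by
    intro k σ
    refine le_trans (density_mono ?_) (density_image_le Sum.inl Sum.inl_injective {x | σ x ≠ x})
    rintro (x | y) h
    · exact ⟨x, fun h' => h (congrArg Sum.inl h'), rfl⟩
    · exact absurd rfl h)

/-- `b ↦ Id ⊕ b`. -/
def inrU (ω : Ultrafilter ℕ) (X Y : ℕ → Type) [∀ k, Finite (X k)] [∀ k, Finite (Y k)] :
    UProd ω Y →* UProd ω (fun k => X k ⊕ Y k) :=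
  UProd.map ω (fun k => inrPerm (X k) (Y k)) (by
    intro k σ
    refine le_trans (density_mono ?_) (density_image_le Sum.inr Sum.inr_injective {x | σ x ≠ x})
    rintro (x | y) h
    · exact absurd rfl h
    · exact ⟨y, fun h' => h (congrArg Sum.inr h'), rfl⟩)

/-- The direct sum `(a, b) ↦ a ⊕ b` of elements of two ultraproducts of symmetric groups. -/
def dsum (ω : Ultrafilter ℕ) (X Y : ℕ → Type) [∀ k, Finite (X k)] [∀ k, Finite (Y k)] :
    UProd ω X × UProd ω Y →* UProd ω (fun k => X k ⊕ Y k) :=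
  MonoidHom.noncommCoprod (inlU ω X Y) (inrU ω X Y) (by
    intro a b
    obtain ⟨σ, rfl⟩ := UProd.exists_rep a
    obtain ⟨τ, rfl⟩ := UProd.exists_rep b
    change UProd.mk ω _ = UProd.mk ω _
    congr 1
    funext k
    ext (x | y) <;> rfl)

/-- A sofic representation of `G`: a homomorphism `Θ : G →* ∏_{k → ω} P_{n k}`, where `n k → ∞`,
with `Tr (Θ g) = 0` for all `g ≠ 1`. -/
structure SoficRep (ω : Ultrafilter ℕ) (G : Type*) [Group G] where
  n : ℕ → ℕ
  n_pos : ∀ k, 0 < n k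
  n_tendsto : Tendsto n atTop atTop
  hom : G →* UProd ω (fun k => Fin (n k))
  trace_zero : ∀ g, g ≠ 1 → ∀ σ : ∀ k, Equiv.Perm (Fin (n k)), UProd.mk ω σ = hom g →
    IsNull ω (fun k => {x | σ k x = x})

/-- Two sofic representations are equivalent if they have amplifications, to the same dimensions,
which are conjugate by a permutation. (Each `u k` is an identification of
`Fin (n k) × Fin (r k)` with `Fin (m k) × Fin (t k)`, so that `n k * r k = m k * t k`.) -/
def Equivalent {ω : Ultrafilter ℕ} {G : Type*} [Group G] (Θ Φ : SoficRep ω G) : Prop :=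
  ∃ r t : ℕ → ℕ, (∀ k, 0 < r k) ∧ (∀ k, 0 < t k) ∧
    ∃ u : ∀ k, Fin (Θ.n k) × Fin (r k) ≃ Fin (Φ.n k) × Fin (t k),
      (conj ω u).comp ((amp ω _ r).comp Θ.hom) = (amp ω _ t).comp Φ.hom

theorem intertwine_iff {ω : Ultrafilter ℕ} {G : Type*} [Group G] {Θ Φ : SoficRep ω G}
    {r t : ℕ → ℕ} (u : ∀ k, Fin (Θ.n k) × Fin (r k) ≃ Fin (Φ.n k) × Fin (t k)) :
    (conj ω u).comp ((amp ω _ r).comp Θ.hom) = (amp ω _ t).comp Φ.hom ↔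
      ∀ g σ φ, UProd.mk ω σ = Θ.hom g → UProd.mk ω φ = Φ.hom g →
        IsNull ω (fun k => {x | u k (ampPerm _ (r k) (σ k) x) ≠ ampPerm _ (t k) (φ k) (u k x)}) := by
  have key : ∀ σ φ, (conj ω u (amp ω _ r (UProd.mk ω σ)) = amp ω _ t (UProd.mk ω φ) ↔
      IsNull ω (fun k =>
        {x | u k (ampPerm _ (r k) (σ k) x) ≠ ampPerm _ (t k) (φ k) (u k x)})) := by
    intro σ φ
    change UProd.mk ω (fun k => (u k).permCongr (ampPerm _ (r k) (σ k))) =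
      UProd.mk ω (fun k => ampPerm _ (t k) (φ k)) ↔ _
    rw [UProd.mk_eq_iff]
    constructor
    · intro h
      refine (IsNull.preimage u h).mono fun k x hx => ?_
      simpa [Equiv.permCongr_apply] using hx
    · intro h
      refine (IsNull.preimage (fun k => (u k).symm) h).mono fun k x hx => ?_
      simpa [Equiv.permCongr_apply] using hx
  constructor
  · intro h g σ φ hσ hφ
    have := DFunLike.congr_fun h g
    simp only [MonoidHom.comp_apply, ← hσ, ← hφ] at this
    exact (key σ φ).1 this
  · intro h
    ext g
    obtain ⟨σ, hσ⟩ := UProd.exists_rep (Θ.hom g)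
    obtain ⟨φ, hφ⟩ := UProd.exists_rep (Φ.hom g)
    simp only [MonoidHom.comp_apply, ← hσ, ← hφ]
    exact (key σ φ).2 (h g σ φ hσ hφ)

theorem equivalent_equivalence (ω : Ultrafilter ℕ) (G : Type*) [Group G] :
    Equivalence (Equivalent (ω := ω) (G := G)) where
  refl Θ := by
    refine ⟨fun _ => 1, fun _ => 1, by simp, by simp, fun k => Equiv.refl _, ?_⟩
    rw [intertwine_iff]
    intro g σ φ hσ hφ
    have h := UProd.mk_eq_iff.1 (hσ.trans hφ.symm)
    refine (IsNull.preimage_fst (Y := fun _ => Fin 1) h).mono fun k x hx h' => hx ?_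
    exact Prod.ext h' rfl
  symm := by
    rintro Θ Φ ⟨r, t, hr, ht, u, hu⟩
    refine ⟨t, r, ht, hr, fun k => (u k).symm, ?_⟩
    rw [intertwine_iff] at hu ⊢
    intro g σ φ hσ hφ
    refine (IsNull.preimage (fun k => (u k).symm) (hu g φ σ hφ hσ)).mono fun k x hx h' => hx ?_
    simp only [Equiv.apply_symm_apply] at h'
    simp [← h']
  trans := by
    rintro Θ Φ Ψ ⟨r, t, hr, ht, u, hu⟩ ⟨a, b, ha, hb, v, hv⟩
    rw [intertwine_iff] at hu hv
    let w₁ : ∀ k, Fin (Θ.n k) × Fin (r k * a k) ≃ (Fin (Θ.n k) × Fin (r k)) × Fin (a k) :=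
      fun k => (Equiv.prodCongr (Equiv.refl _) finProdFinEquiv.symm).trans
        (Equiv.prodAssoc _ _ _).symm
    let w₂ : ∀ k, (Fin (Θ.n k) × Fin (r k)) × Fin (a k) ≃ (Fin (Φ.n k) × Fin (a k)) × Fin (t k) :=
      fun k => (Equiv.prodCongr (u k) (Equiv.refl _)).trans
        ((Equiv.prodAssoc _ _ _).trans
          ((Equiv.prodCongr (Equiv.refl _) (Equiv.prodComm _ _)).trans (Equiv.prodAssoc _ _ _).symm))
    let w₃ : ∀ k, (Fin (Ψ.n k) × Fin (b k)) × Fin (t k) ≃ Fin (Ψ.n k) × Fin (b k * t k) :=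
      fun k => (Equiv.prodAssoc _ _ _).trans (Equiv.prodCongr (Equiv.refl _) finProdFinEquiv)
    refine ⟨fun k => r k * a k, fun k => b k * t k, fun k => Nat.mul_pos (hr k) (ha k),
      fun k => Nat.mul_pos (hb k) (ht k),
      fun k => (w₁ k).trans ((w₂ k).trans
        ((Equiv.prodCongr (v k) (Equiv.refl _)).trans (w₃ k))), ?_⟩
    rw [intertwine_iff]
    intro g σ ψ hσ hψ
    obtain ⟨φ, hφ⟩ := UProd.exists_rep (Φ.hom g)
    have h1 := IsNull.preimage w₁
      (IsNull.preimage_fst (Y := fun k => Fin (a k)) (hu g σ φ hσ hφ))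
    have h2 := IsNull.preimage (fun k => (w₁ k).trans (w₂ k))
      (IsNull.preimage_fst (Y := fun k => Fin (t k)) (hv g φ ψ hφ hψ))
    refine (h1.union h2).mono fun k x hx => ?_
    by_contra hc
    apply hx
    simp only [Set.mem_union, Set.mem_preimage, Set.mem_ofPred_eq, not_or, not_not] at hc
    obtain ⟨hc1, hc2⟩ := hc
    obtain ⟨x, i⟩ := x
    have e1 : w₁ k (ampPerm _ (r k * a k) (σ k) (x, i)) =
        (ampPerm _ (r k) (σ k) (w₁ k (x, i)).1, (w₁ k (x, i)).2) := rfl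
    have e2 : ∀ y, w₂ k y = (((u k y.1).1, y.2), (u k y.1).2) := fun _ => rfl
    have e3 : ∀ y, w₃ k (ampPerm _ (b k) (ψ k) y.1, y.2) =
        ampPerm _ (b k * t k) (ψ k) (w₃ k y) := fun _ => rfl
    simp only [Equiv.trans_apply, Equiv.prodCongr_apply, Prod.map, Equiv.refl_apply, e1]
    simp only [Equiv.trans_apply, e2] at hc2
    simp only [e2, hc1]
    change w₃ k (v k (ampPerm _ (a k) (φ k) ((u k (w₁ k (x, i)).1).1, (w₁ k (x, i)).2)),
      (u k (w₁ k (x, i)).1).2) = _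
    rw [hc2]
    exact e3 (_, _)

/-- Equivalence of sofic representations, as a setoid. -/
instance soficSetoid (ω : Ultrafilter ℕ) (G : Type*) [Group G] : Setoid (SoficRep ω G) :=
  ⟨Equivalent, equivalent_equivalence ω G⟩

/-- The space `Sof(G, P^ω)` of classes of sofic representations. -/
abbrev Sof (ω : Ultrafilter ℕ) (G : Type*) [Group G] := Quotient (soficSetoid ω G)

/-- The class `[Θ]` of a sofic representation. -/
def SoficRep.cls {ω : Ultrafilter ℕ} {G : Type*} [Group G] (Θ : SoficRep ω G) : Sof ω G :=
  Quotient.mk (soficSetoid ω G) Θ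

/-- `IsConvComb c x y z`: `z = c x + (1 - c) y` in the convex-like structure of `Sof(G, P^ω)`.
That is, `z` is the class of a direct sum `(Θ₁ ⊗ Id_{r k}) ⊕ (Θ₂ ⊗ Id_{t k})` with `[Θ₁] = x`,
`[Θ₂] = y`, in which the first summand occupies asymptotically the proportion `c` of the space. -/
def IsConvComb {ω : Ultrafilter ℕ} {G : Type*} [Group G] (c : ℝ) (x y z : Sof ω G) : Prop :=
  ∃ Θ₁ Θ₂ Φ : SoficRep ω G, Θ₁.cls = x ∧ Θ₂.cls = y ∧ Φ.cls = z ∧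
    ∃ r t : ℕ → ℕ, (∀ k, 0 < r k) ∧ (∀ k, 0 < t k) ∧
      Tendsto (fun k => ((Θ₁.n k * r k : ℕ) : ℝ) / ((Θ₁.n k * r k + Θ₂.n k * t k : ℕ) : ℝ))
        (ω : Filter ℕ) (𝓝 c) ∧
      ∃ u : ∀ k, (Fin (Θ₁.n k) × Fin (r k)) ⊕ (Fin (Θ₂.n k) × Fin (t k)) ≃ Fin (Φ.n k),
        Φ.hom = (conj ω u).comp ((dsum ω _ _).comp
          (((amp ω _ r).comp Θ₁.hom).prod ((amp ω _ t).comp Θ₂.hom)))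

/-- Extreme points of `Sof(G, P^ω)`. -/
def IsExtreme {ω : Ultrafilter ℕ} {G : Type*} [Group G] (z : Sof ω G) : Prop :=
  ∀ c : ℝ, 0 < c → c < 1 → ∀ x y : Sof ω G, IsConvComb c x y z → x = z ∧ y = z

/-- Faces of `Sof(G, P^ω)`: nonempty convex subsets `F` such that `x, y ∈ F` as soon as some
`c x + (1 - c) y` with `0 < c < 1` belongs to `F`. -/
structure IsFace {ω : Ultrafilter ℕ} {G : Type*} [Group G] (F : Set (Sof ω G)) : Prop where
  nonempty : F.Nonempty
  convex : ∀ c : ℝ, 0 ≤ c → c ≤ 1 → ∀ x ∈ F, ∀ y ∈ F, ∀ z, IsConvComb c x y z → z ∈ F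
  mem_of_convComb : ∀ c : ℝ, 0 < c → c < 1 → ∀ x y z, IsConvComb c x y z → z ∈ F → x ∈ F ∧ y ∈ F

/-- The projection `p = ∏_{k → ω} p_k` of `∏_{k → ω} D(X k)`, where `p_k` is the projection on the
subset `S k` of `X k`, commutes with the image of `Θ`. (Every projection of `∏_{k → ω} D(X k)` is
of this form, and `S`, `T` give the same projection iff `S k ∆ T k` is negligible.) -/
def Commutes {ω : Ultrafilter ℕ} {G : Type*} [Group G] {X : ℕ → Type} [∀ k, Finite (X k)]
    (Θ : G →* UProd ω X) (S : ∀ k, Set (X k)) : Prop :=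
  ∀ g, ∀ σ, UProd.mk ω σ = Θ g → IsNull ω (fun k => {x | ¬ (σ k x ∈ S k ↔ x ∈ S k)})

/-- `IsCut Θ S Φ`: the projection `p` given by `S` is nonzero, commutes with `Θ`, and the sofic
representation `Φ : G →* ∏_{k → ω} P_{m k}` is a version of `Θ_p = p Θ`. The latter means that,
up to negligible sets, bijections `e k` between `Fin (m k)` and `S k` intertwine `Φ` with the
restriction of `Θ` to the subsets `S k`; in particular `m k / |X k| → Tr p` along `ω`. -/
def IsCut {ω : Ultrafilter ℕ} {G : Type*} [Group G] {X : ℕ → Type} [∀ k, Finite (X k)]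
    (Θ : G →* UProd ω X) (S : ∀ k, Set (X k)) (Φ : SoficRep ω G) : Prop :=
  ¬ IsNull ω S ∧ Commutes Θ S ∧
    ∃ e : ∀ k, PartialEquiv (Fin (Φ.n k)) (X k),
      IsNull ω (fun k => (e k).sourceᶜ) ∧
      IsNull ω (fun k => symmDiff (e k).target (S k)) ∧
      ∀ g σ φ, UProd.mk ω σ = Θ g → UProd.mk ω φ = Φ.hom g →
        IsNull ω (fun k => {y | y ∈ (e k).source ∧ φ k y ∈ (e k).source ∧
          e k (φ k y) = σ k (e k y)}ᶜ)

/-- The set `F_{[Θ]} = {[Θ_p] : p a (nonzero) cutting projection of Θ}`, where `p` ranges over the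
projections of `∏_{k → ω} D_{n k * r k}` commuting with `Θ ⊗ Id_{r k}`, for all sequences `r`. -/
def faceOf {ω : Ultrafilter ℕ} {G : Type*} [Group G] (Θ : SoficRep ω G) : Set (Sof ω G) :=
  {z | ∃ r : ℕ → ℕ, (∀ k, 0 < r k) ∧ ∃ S : ∀ k, Set (Fin (Θ.n k) × Fin (r k)),
    ∃ Φ : SoficRep ω G, IsCut ((amp ω _ r).comp Θ.hom) S Φ ∧ Φ.cls = z}

/-- For pairwise orthogonal projections `p i` given by subsets `S i k` of `X k`, the tail
`q j = ∑_{i ≥ j} p i = Id - ∑_{i < j} p i` (when `∑ i, p i = Id`), as subsets of `X k`. -/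
def tail {X : ℕ → Type} (S : ℕ → ∀ k, Set (X k)) (j : ℕ) : ∀ k, Set (X k) :=
  fun k => (⋃ i ∈ Finset.range j, S i k)ᶜ

/-- `Ψ` is an infinite convex combination `∑ i, c i • x i` in `Sof(G, P^ω)`, with associated
cutting projections `p i ∈ ∏_{k → ω} D_{n k}` given by the sets `S i k`: these are pairwise
orthogonal with `Tr (p i) = c i`, `∑ i, p i = Id` and `[Ψ_{p i}] = x i`. -/
structure IsInfConvComb {ω : Ultrafilter ℕ} {G : Type*} [Group G] (c : ℕ → ℝ) (x : ℕ → Sof ω G)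
    (Ψ : SoficRep ω G) (S : ℕ → ∀ k, Set (Fin (Ψ.n k))) : Prop where
  orthogonal : ∀ i j, i ≠ j → IsNull ω (fun k => S i k ∩ S j k)
  trace_eq : ∀ i, tr ω (S i) = c i
  sum_eq_one : Tendsto (fun j => tr ω (tail S j)) atTop (𝓝 0)
  cut_eq : ∀ i, ∃ Φ : SoficRep ω G, IsCut Ψ.hom (S i) Φ ∧ Φ.cls = x i

end

end SoficSpace

/-!
Sofic representations are handled through *almost actions*: sequences of permutations of finite
sets, multiplicative and fixed point free up to sets of density tending to `0` along `ω`. Cuts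
become *embeddings* (`AlmostAction.Emb`): maps which are injective off null sets, equivariant off
null sets, and whose range does not become negligible. Up to null sets the range of an embedding is
invariant (`EmbOnto.invariant`), every invariant sequence of sets which is not null is such a range
(`Invariant.exists_embOnto`), and an embedding whose range has null complement gives equivalent
sofic representations (`cls_eq_of_emb`).

Allowing amplifications on both sides gives a preorder `Sub` which depends only on the classes, and
`F_{[Θ]}` is the set of classes below `Θ` (`cls_mem_faceOf`). That it is a face
(`isFace_faceOf`) then says that a direct sum is below `Θ` if and only if both summands are. If `B`
is extreme and `A` is a cut of `B`, then `B` is the direct sum of `A` and of the complementary cut,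
so `A` is equivalent to `B` (`Sub.cls_eq_of_isExtreme`).

Let now `Ψ` be an infinite convex combination of the extreme points `x i`. The space of a
representation `C` below the `j`-th tail is covered by the preimages of the pieces `p i`, `i ≥ j`,
up to sets of small density, so one of these preimages is not null; cutting by it gives a
representation below both `C` and `x i` (`exists_common_cut`). By extremality it is equivalent to
`x i`. If `C` is itself the extreme point `x m` with `m < j`, it is also equivalent to `x m`, which
contradicts `x i ≠ x m`; hence `x j` belongs to `F j` but not to `F (j + 1)`. If the class of `C`
were in all the `F j`, some `x i` would be below `C`, hence in `F (i + 1)`, which has just been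
excluded.

For the existence of `Ψ`, the `k`-th finite set is the disjoint union of amplifications of the
`k`-th sets of the first `k + 1` representations, in proportions converging to `c i`. Since
`∑ i, c i = 1`, no mass escapes to the blocks of large index, so null sets, and with them the
defining properties of an almost action, can be checked on each block (`IsNull.of_blocks`).
-/

open Filter Topology

namespace SoficSpace

noncomputable section

/-! ### Densities and negligible sequences of sets -/

theorem density_univ {X : Type} [Finite X] [Nonempty X] : density (Set.univ : Set X) = 1 := by
  have : (0 : ℝ) < Nat.card X := by exact_mod_cast Nat.card_pos
  rw [density, Set.ncard_univ, div_self this.ne']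

theorem density_compl {X : Type} [Finite X] [Nonempty X] (S : Set X) :
    density Sᶜ = 1 - density S := by
  have : (0 : ℝ) < Nat.card X := by exact_mod_cast Nat.card_pos
  have h : (S.ncard : ℝ) + Sᶜ.ncard = Nat.card X := by exact_mod_cast Set.ncard_add_ncard_compl S
  rw [density, density, eq_sub_iff_add_eq, ← add_div, add_comm, h, div_self this.ne']

theorem density_mul_card {X : Type} [Finite X] [Nonempty X] (S : Set X) :
    density S * Nat.card X = S.ncard := by
  have : (0 : ℝ) < Nat.card X := by exact_mod_cast Nat.card_pos
  rw [density, div_mul_cancel₀ _ this.ne']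

/-- Pulling back along a map which is injective on `D` multiplies densities at most by the ratio of
the cardinalities, up to the complement of `D`. -/
theorem density_preimage_le {X Y : Type} [Finite X] [Finite Y] [Nonempty X] [Nonempty Y]
    {f : Y → X} {D : Set Y} (hf : D.InjOn f) {C : ℝ}
    (hC : (Nat.card X : ℝ) ≤ C * Nat.card Y) (N : Set X) :
    density (f ⁻¹' N) ≤ density Dᶜ + C * density N := by
  have hX : (0 : ℝ) < Nat.card X := by exact_mod_cast Nat.card_pos
  have hY : (0 : ℝ) < Nat.card Y := by exact_mod_cast Nat.card_pos
  have h1 : f ⁻¹' N ⊆ Dᶜ ∪ (f ⁻¹' N ∩ D) := fun y hy => by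
    by_cases h : y ∈ D
    · exact Or.inr ⟨hy, h⟩
    · exact Or.inl h
  refine (density_mono h1).trans ((density_union_le _ _).trans ?_)
  gcongr
  have h2 : (f ⁻¹' N ∩ D).ncard ≤ N.ncard := by
    rw [← (hf.mono Set.inter_subset_right).ncard_image]
    refine Set.ncard_le_ncard ?_ (Set.toFinite _)
    rintro _ ⟨y, hy, rfl⟩
    exact hy.1
  calc density (f ⁻¹' N ∩ D) ≤ N.ncard / Nat.card Y := by
        unfold density; gcongr
    _ ≤ C * density N := by
        rw [div_le_iff₀ hY]
        calc (N.ncard : ℝ) = density N * Nat.card X := (density_mul_card N).symm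
          _ ≤ density N * (C * Nat.card Y) := by gcongr; exact density_nonneg N
          _ = _ := by ring

theorem IsNull.mono_eventually {ω : Ultrafilter ℕ} {X : ℕ → Type} [∀ k, Finite (X k)]
    {S T : ∀ k, Set (X k)} (hT : IsNull ω T) (h : ∀ᶠ k in (ω : Filter ℕ), S k ⊆ T k) :
    IsNull ω S :=
  squeeze_zero' (Eventually.of_forall fun _ => density_nonneg _)
    (h.mono fun _ hk => density_mono hk) hT

theorem isNull_empty {ω : Ultrafilter ℕ} {X : ℕ → Type} :
    IsNull ω (fun k => (∅ : Set (X k))) := by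
  simp [IsNull, density]

theorem isNull_of_forall_notMem {ω : Ultrafilter ℕ} {X : ℕ → Type} {S : ∀ k, Set (X k)}
    (h : ∀ k x, x ∉ S k) : IsNull ω S := by
  have : S = fun _ => ∅ := funext fun k => Set.eq_empty_of_forall_notMem (h k)
  exact this ▸ isNull_empty

theorem not_isNull_univ {ω : Ultrafilter ℕ} {X : ℕ → Type} [∀ k, Finite (X k)]
    [∀ k, Nonempty (X k)] : ¬ IsNull ω (fun k => (Set.univ : Set (X k))) := by
  intro h
  simp only [IsNull, density_univ] at h
  exact one_ne_zero (tendsto_nhds_unique tendsto_const_nhds h)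

/-- A sequence of sets with null complements is not null. -/
theorem not_isNull_of_compl {ω : Ultrafilter ℕ} {X : ℕ → Type} [∀ k, Finite (X k)]
    [∀ k, Nonempty (X k)] {S : ∀ k, Set (X k)} (h : IsNull ω fun k => (S k)ᶜ) :
    ¬ IsNull ω S := fun h' =>
  not_isNull_univ (ω := ω) ((h.union h').mono fun k x _ => by simp)

/-- A sequence of sets which is not null has density bounded below along `ω`. -/
theorem exists_le_density {ω : Ultrafilter ℕ} {X : ℕ → Type} [∀ k, Finite (X k)]
    {S : ∀ k, Set (X k)} (h : ¬ IsNull ω S) :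
    ∃ δ > 0, ∀ᶠ k in (ω : Filter ℕ), δ ≤ density (S k) := by
  have ht := tendsto_tr ω S
  have h0 : 0 ≤ tr ω S := ge_of_tendsto' ht fun k => density_nonneg _
  have hne : tr ω S ≠ 0 := fun h1 => h (by rw [h1] at ht; exact ht)
  have hpos : 0 < tr ω S := lt_of_le_of_ne h0 hne.symm
  exact ⟨tr ω S / 2, by positivity, ht.eventually (eventually_ge_nhds (by linarith))⟩

theorem tr_eq_of_tendsto {ω : Ultrafilter ℕ} {X : ℕ → Type} {S : ∀ k, Set (X k)} {a : ℝ}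
    (h : Tendsto (fun k => density (S k)) (ω : Filter ℕ) (𝓝 a)) : tr ω S = a :=
  h.limUnder_eq

/-- Null sets can be detected piecewise on a sequence of sets whose tails have small trace. -/
theorem isNull_of_forall_inter {ω : Ultrafilter ℕ} {X : ℕ → Type} [∀ k, Finite (X k)]
    {S : ℕ → ∀ k, Set (X k)}
    (hS : ∀ ε > 0, ∃ m, ∀ᶠ k in (ω : Filter ℕ), density (tail S m k) ≤ ε)
    {N : ∀ k, Set (X k)} (hN : ∀ i, IsNull ω fun k => N k ∩ S i k) : IsNull ω N := by
  have hU : ∀ m, IsNull ω fun k => N k ∩ ⋃ i ∈ Finset.range m, S i k := by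
    intro m
    induction m with
    | zero => simpa using isNull_empty (ω := ω)
    | succ m ih =>
      refine (ih.union (hN m)).mono fun k x hx => ?_
      simp only [Set.mem_inter_iff, Set.mem_iUnion, Finset.mem_range, Nat.lt_succ_iff_lt_or_eq,
        Set.mem_union] at hx ⊢
      obtain ⟨h1, i, hi | rfl, h2⟩ := hx
      · exact Or.inl ⟨h1, i, hi, h2⟩
      · exact Or.inr ⟨h1, h2⟩
  refine (tendsto_order.2 ⟨fun a ha => Eventually.of_forall fun k =>
    ha.trans_le (density_nonneg _), fun ε hε => ?_⟩)
  obtain ⟨m, hm⟩ := hS (ε / 2) (by positivity)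
  filter_upwards [hm, (hU m).eventually (eventually_lt_nhds (half_pos hε))] with k h1 h2
  have : N k ⊆ (N k ∩ ⋃ i ∈ Finset.range m, S i k) ∪ tail S m k := fun x hx => by
    by_cases h : x ∈ ⋃ i ∈ Finset.range m, S i k
    · exact Or.inl ⟨hx, h⟩
    · exact Or.inr h
  calc density (N k) ≤ _ := (density_mono this).trans (density_union_le _ _)
    _ < ε := by linarith

/-! ### Essentially injective sequences of maps -/

/-- A sequence of maps between finite sets is essentially injective if it is injective off a null
sequence of sets and if its range does not become negligible; the latter is expressed by an
eventual bound on the ratio of the cardinalities. -/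
structure EssInjective (ω : Ultrafilter ℕ) {Y X : ℕ → Type} (f : ∀ k, Y k → X k) : Prop where
  exists_injOn : ∃ D : ∀ k, Set (Y k), IsNull ω (fun k => (D k)ᶜ) ∧ ∀ k, (D k).InjOn (f k)
  card_le : ∃ C : ℝ, 0 < C ∧
    ∀ᶠ k in (ω : Filter ℕ), (Nat.card (X k) : ℝ) ≤ C * Nat.card (Y k)

section
variable {ω : Ultrafilter ℕ} {X Y Z : ℕ → Type}

theorem EssInjective.of_injective {f : ∀ k, Y k → X k} (hf : ∀ k, (f k).Injective) {C : ℝ}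
    (hC : 0 < C) (h : ∀ᶠ k in (ω : Filter ℕ), (Nat.card (X k) : ℝ) ≤ C * Nat.card (Y k)) :
    EssInjective ω f :=
  ⟨⟨fun _ => Set.univ, by simpa using isNull_empty (ω := ω), fun k => (hf k).injOn⟩, C, hC, h⟩

theorem EssInjective.of_equiv (e : ∀ k, Y k ≃ X k) : EssInjective ω (fun k => e k) :=
  .of_injective (fun k => (e k).injective) one_pos
    (Eventually.of_forall fun k => by rw [Nat.card_congr (e k), one_mul])

variable [∀ k, Finite (X k)] [∀ k, Finite (Y k)] [∀ k, Nonempty (Y k)]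

theorem card_le_two_mul_of_injOn {f : ∀ k, Y k → X k} {D : ∀ k, Set (Y k)}
    (hD : IsNull ω (fun k => (D k)ᶜ)) (hf : ∀ k, (D k).InjOn (f k)) :
    ∀ᶠ k in (ω : Filter ℕ), (Nat.card (Y k) : ℝ) ≤ 2 * Nat.card (X k) := by
  filter_upwards [hD.eventually (eventually_lt_nhds (half_pos one_pos))] with k hk
  rw [density_compl] at hk
  have hY : (0 : ℝ) < Nat.card (Y k) := by exact_mod_cast Nat.card_pos
  have h1 := density_mul_card (D k)
  have h2 : ((D k).ncard : ℝ) ≤ Nat.card (X k) := by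
    rw [← (hf k).ncard_image]
    exact_mod_cast Set.ncard_le_card _
  nlinarith

theorem EssInjective.card_le_two_mul {f : ∀ k, Y k → X k} (hf : EssInjective ω f) :
    ∀ᶠ k in (ω : Filter ℕ), (Nat.card (Y k) : ℝ) ≤ 2 * Nat.card (X k) :=
  let ⟨⟨_, hD, hinj⟩, _⟩ := hf
  card_le_two_mul_of_injOn hD hinj

variable [∀ k, Nonempty (X k)]

theorem EssInjective.exists_density_preimage_le {f : ∀ k, Y k → X k} (hf : EssInjective ω f) :
    ∃ D : ∀ k, Set (Y k), IsNull ω (fun k => (D k)ᶜ) ∧ ∃ C : ℝ, 0 < C ∧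
      ∀ᶠ k in (ω : Filter ℕ), ∀ N : Set (X k),
        density (f k ⁻¹' N) ≤ density (D k)ᶜ + C * density N := by
  obtain ⟨⟨D, hD, hinj⟩, C, hC, hle⟩ := hf
  exact ⟨D, hD, C, hC, hle.mono fun k hk N => density_preimage_le (hinj k) hk N⟩

theorem EssInjective.isNull_preimage {f : ∀ k, Y k → X k} (hf : EssInjective ω f)
    {N : ∀ k, Set (X k)} (hN : IsNull ω N) : IsNull ω (fun k => f k ⁻¹' N k) := by
  obtain ⟨D, hD, C, hC, hle⟩ := hf.exists_density_preimage_le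
  refine squeeze_zero' (Eventually.of_forall fun _ => density_nonneg _)
    (hle.mono fun k hk => hk (N k)) ?_
  simpa using Tendsto.add hD (Tendsto.const_mul C hN)

theorem EssInjective.isNull_image {f : ∀ k, Y k → X k} (hf : EssInjective ω f)
    {M : ∀ k, Set (Y k)} (hM : IsNull ω M) : IsNull ω (fun k => f k '' M k) := by
  refine squeeze_zero' (Eventually.of_forall fun _ => density_nonneg _)
    (hf.card_le_two_mul.mono fun k hk => ?_) (by simpa using Tendsto.const_mul 2 hM)
  have hX : (0 : ℝ) < Nat.card (X k) := by exact_mod_cast Nat.card_pos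
  have h1 : ((f k '' M k).ncard : ℝ) ≤ (M k).ncard := by
    exact_mod_cast Set.ncard_image_le (Set.toFinite _)
  rw [density, div_le_iff₀ hX]
  calc ((f k '' M k).ncard : ℝ) ≤ density (M k) * Nat.card (Y k) := by rwa [density_mul_card]
    _ ≤ density (M k) * (2 * Nat.card (X k)) := by gcongr; exact density_nonneg _
    _ = _ := by ring

theorem EssInjective.isNull_of_preimage {f : ∀ k, Y k → X k} (hf : EssInjective ω f)
    {N : ∀ k, Set (X k)} (hN : IsNull ω (fun k => f k ⁻¹' N k))
    (hr : IsNull ω fun k => N k \ Set.range (f k)) : IsNull ω N := by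
  refine ((hf.isNull_image hN).union hr).mono fun k x hx => ?_
  by_cases h : x ∈ Set.range (f k)
  · obtain ⟨y, rfl⟩ := h
    exact Or.inl ⟨y, hx, rfl⟩
  · exact Or.inr ⟨hx, h⟩

theorem EssInjective.comp {g : ∀ k, X k → Z k} {f : ∀ k, Y k → X k} (hg : EssInjective ω g)
    (hf : EssInjective ω f) : EssInjective ω (fun k => g k ∘ f k) := by
  obtain ⟨⟨D', hD', hinj'⟩, C', hC', hle'⟩ := id hg
  obtain ⟨⟨D, hD, hinj⟩, C, hC, hle⟩ := id hf
  refine ⟨⟨fun k => D k ∩ f k ⁻¹' D' k, (hD.union (hf.isNull_preimage hD')).mono fun k x hx => ?_,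
    fun k => (hinj' k).comp ((hinj k).mono Set.inter_subset_left) fun x hx => hx.2⟩,
    C' * C, by positivity, ?_⟩
  · rw [Set.compl_inter] at hx
    exact hx
  · filter_upwards [hle, hle'] with k h h'
    calc _ ≤ _ := h'
      _ ≤ C' * (C * Nat.card (Y k)) := by gcongr
      _ = _ := by ring

end

/-- A factor `h` of an essentially injective `g ∘ h = f` (almost everywhere) is essentially
injective. -/
theorem EssInjective.of_comp {ω : Ultrafilter ℕ} {X Y Z : ℕ → Type} [∀ k, Finite (X k)]
    [∀ k, Finite (Y k)] [∀ k, Nonempty (X k)] [∀ k, Finite (Z k)]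
    {g : ∀ k, X k → Z k} {h : ∀ k, Y k → X k} {f : ∀ k, Y k → Z k}
    (hf : EssInjective ω f) (hg : EssInjective ω g)
    (hfg : IsNull ω fun k => {y | g k (h k y) ≠ f k y}) : EssInjective ω h := by
  obtain ⟨⟨D, hD, hinj⟩, C, hC, hle⟩ := hf
  refine ⟨⟨fun k => D k ∩ {y | g k (h k y) = f k y}, (hD.union hfg).mono fun k x hx => ?_,
    fun k x hx y hy hxy => hinj k hx.1 hy.1 ?_⟩, 2 * C, by positivity, ?_⟩
  · rw [Set.compl_inter] at hx
    exact hx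
  · rw [← hx.2, ← hy.2, hxy]
  · filter_upwards [hle, hg.card_le_two_mul] with k h1 h2
    linarith

/-! ### Almost actions on sequences of finite sets -/

/-- A sofic representation with chosen representatives: permutations `perm g k` of finite nonempty
sets `X k`, of cardinality tending to infinity, which are multiplicative in `g` and fixed point
free for `g ≠ 1` up to null sequences of sets. -/
structure AlmostAction (ω : Ultrafilter ℕ) (G : Type*) [Group G] where
  X : ℕ → Type
  finite : ∀ k, Finite (X k)
  nonempty : ∀ k, Nonempty (X k)
  tendsto_card : Tendsto (fun k => Nat.card (X k)) atTop atTop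
  perm : G → ∀ k, Equiv.Perm (X k)
  mul : ∀ g h, IsNull ω fun k => {x | perm (g * h) k x ≠ perm g k (perm h k x)}
  free : ∀ g, g ≠ 1 → IsNull ω fun k => {x | perm g k x = x}

attribute [instance] AlmostAction.finite AlmostAction.nonempty

variable {ω : Ultrafilter ℕ} {G : Type*} [Group G]

namespace AlmostAction

/-- The homomorphism into the ultraproduct defined by an almost action. -/
def hom (A : AlmostAction ω G) : G →* UProd ω A.X :=
  MonoidHom.mk' (fun g => UProd.mk ω (A.perm g)) fun g h => UProd.mk_eq_iff.2 (A.mul g h)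

/-- The almost action `A` realises the sofic representation `Θ` under the identifications `e k`. -/
def Presents (A : AlmostAction ω G) (Θ : SoficRep ω G) (e : ∀ k, A.X k ≃ Fin (Θ.n k)) : Prop :=
  ∀ g, Θ.hom g = UProd.mk ω fun k => (e k).permCongr (A.perm g k)

/-- The sofic representation obtained from an almost action by enumerating the finite sets. -/
def toRep (A : AlmostAction ω G) : SoficRep ω G where
  n k := Nat.card (A.X k)
  n_pos _ := Nat.card_pos
  n_tendsto := A.tendsto_card
  hom := (conj ω fun k => Finite.equivFin (A.X k)).comp A.hom
  trace_zero g hg σ hσ := by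
    have h := UProd.mk_eq_iff.1 (hσ.trans (show _ = UProd.mk ω
      (fun k => (Finite.equivFin (A.X k)).permCongr (A.perm g k)) from rfl))
    refine (h.union ((A.free g hg).preimage fun k => (Finite.equivFin (A.X k)).symm)).mono
      fun k x hx => ?_
    by_contra hc
    simp only [Set.mem_union, Set.mem_preimage, Set.mem_ofPred_eq, not_or, not_not] at hc hx
    apply hc.2
    rw [hc.1] at hx
    exact (Equiv.eq_symm_apply _).2 hx

theorem presents_toRep (A : AlmostAction ω G) :
    A.Presents A.toRep fun k => Finite.equivFin (A.X k) := fun _ => rfl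

/-- A choice of permutations representing `Θ g`. -/
def repPerm (Θ : SoficRep ω G) (g : G) : ∀ k, Equiv.Perm (Fin (Θ.n k)) :=
  (UProd.exists_rep (Θ.hom g)).choose

theorem mk_repPerm (Θ : SoficRep ω G) (g : G) : UProd.mk ω (repPerm Θ g) = Θ.hom g :=
  (UProd.exists_rep (Θ.hom g)).choose_spec

/-- The almost action given by a choice of representatives of a sofic representation. -/
def ofRep (Θ : SoficRep ω G) : AlmostAction ω G where
  X k := Fin (Θ.n k)
  finite _ := inferInstance
  nonempty k := ⟨⟨0, Θ.n_pos k⟩⟩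
  tendsto_card := by simpa using Θ.n_tendsto
  perm g := repPerm Θ g
  mul g h := by
    refine UProd.mk_eq_iff (τ := fun k => repPerm Θ g k * repPerm Θ h k).1 ?_
    rw [mk_repPerm, map_mul, ← mk_repPerm, ← mk_repPerm]
    exact (map_mul (QuotientGroup.mk' (nullSubgroup ω _)) (repPerm Θ g) (repPerm Θ h)).symm
  free g hg := Θ.trace_zero g hg _ (mk_repPerm Θ g)

theorem hom_ofRep (Θ : SoficRep ω G) : (ofRep Θ).hom = Θ.hom :=
  MonoidHom.ext fun g => mk_repPerm Θ g

theorem presents_ofRep (Θ : SoficRep ω G) : (ofRep Θ).Presents Θ fun _ => Equiv.refl _ :=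
  fun g => (mk_repPerm Θ g).symm

/-- The class in `Sof(G, P^ω)` of an almost action. -/
def cls (A : AlmostAction ω G) : Sof ω G := A.toRep.cls

/-- The amplification of an almost action. -/
def amp (A : AlmostAction ω G) (r : ℕ → ℕ+) : AlmostAction ω G where
  X k := A.X k × Fin (r k)
  finite _ := inferInstance
  nonempty k := ⟨⟨Classical.arbitrary _, ⟨0, (r k).pos⟩⟩⟩
  tendsto_card := by
    refine tendsto_atTop_mono (fun k => ?_) A.tendsto_card
    rw [Nat.card_prod, Nat.card_fin]
    exact Nat.le_mul_of_pos_right _ (r k).pos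
  perm g k := ampPerm (A.X k) (r k) (A.perm g k)
  mul g h := (A.mul g h).preimage_fst.mono fun k x hx h' => hx (Prod.ext h' rfl)
  free g hg := (A.free g hg).preimage_fst.mono fun k x hx => congrArg Prod.fst hx

theorem card_amp (A : AlmostAction ω G) (r : ℕ → ℕ+) (k : ℕ) :
    Nat.card ((A.amp r).X k) = Nat.card (A.X k) * r k := by
  change Nat.card (A.X k × Fin (r k)) = _
  rw [Nat.card_prod, Nat.card_fin]

/-! ### Equivalence of sofic representations through almost actions -/

/-- An almost equivariant bijection between amplifications is an equivalence of the presented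
representations, whatever the representatives and enumerations. -/
theorem Presents.equivalent {A B : AlmostAction ω G} {Θ Φ : SoficRep ω G}
    {e : ∀ k, A.X k ≃ Fin (Θ.n k)} {e' : ∀ k, B.X k ≃ Fin (Φ.n k)} (hA : A.Presents Θ e)
    (hB : B.Presents Φ e') {s t : ℕ → ℕ+} (u : ∀ k, A.X k × Fin (s k) ≃ B.X k × Fin (t k))
    (hu : ∀ g, IsNull ω fun k =>
      {x | u k (ampPerm _ _ (A.perm g k) x) ≠ ampPerm _ _ (B.perm g k) (u k x)}) : Equivalent Θ Φ := by
  let a : ∀ k, Fin (Θ.n k) × Fin (s k) ≃ A.X k × Fin (s k) :=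
    fun k => ((e k).prodCongr (Equiv.refl _)).symm
  let b : ∀ k, B.X k × Fin (t k) ≃ Fin (Φ.n k) × Fin (t k) :=
    fun k => (e' k).prodCongr (Equiv.refl _)
  refine ⟨fun k => s k, fun k => t k, fun k => (s k).pos, fun k => (t k).pos,
    fun k => (a k).trans ((u k).trans (b k)), ?_⟩
  rw [intertwine_iff]
  intro g σ φ hσ hφ
  have h1 := IsNull.preimage_fst (Y := fun k => Fin (s k)) (UProd.mk_eq_iff.1 (hσ.trans (hA g)))
  have h2 := IsNull.preimage (fun k => (a k).trans ((u k).trans (b k)))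
    (IsNull.preimage_fst (Y := fun k => Fin (t k)) (UProd.mk_eq_iff.1 (hφ.trans (hB g))))
  refine ((h1.union h2).union ((hu g).preimage a)).mono fun k x hx => ?_
  by_contra hc
  simp only [Set.mem_union, Set.mem_preimage, Set.mem_ofPred_eq, not_or, not_not] at hc
  obtain ⟨⟨hc1, hc2⟩, hc3⟩ := hc
  apply hx
  have e1 : a k (ampPerm _ (s k) (σ k) x) = ampPerm _ _ (A.perm g k) (a k x) := by
    refine Prod.ext ?_ rfl
    change (e k).symm (σ k x.1) = A.perm g k ((e k).symm x.1)
    rw [hc1]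
    simp [Equiv.permCongr_apply]
  have e2 : ∀ y, φ k (b k y).1 = (e' k).permCongr (B.perm g k) (b k y).1 →
      b k (ampPerm _ _ (B.perm g k) y) = ampPerm _ (t k) (φ k) (b k y) := by
    intro y hy
    refine Prod.ext ?_ rfl
    change e' k (B.perm g k y.1) = φ k (b k y).1
    rw [hy, Equiv.permCongr_apply]
    change _ = e' k (B.perm g k ((e' k).symm (e' k y.1)))
    rw [Equiv.symm_apply_apply]
  simp only [Equiv.trans_apply] at hc2 ⊢
  rw [e1, hc3, e2 _ hc2]

theorem Presents.exists_of_equivalent {A B : AlmostAction ω G} {Θ Φ : SoficRep ω G}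
    {e : ∀ k, A.X k ≃ Fin (Θ.n k)} {e' : ∀ k, B.X k ≃ Fin (Φ.n k)} (hA : A.Presents Θ e)
    (hB : B.Presents Φ e') (h : Equivalent Θ Φ) :
    ∃ (s t : ℕ → ℕ+) (u : ∀ k, A.X k × Fin (s k) ≃ B.X k × Fin (t k)), ∀ g, IsNull ω fun k =>
      {x | u k (ampPerm _ _ (A.perm g k) x) ≠ ampPerm _ _ (B.perm g k) (u k x)} := by
  obtain ⟨s, t, hs, ht, u, hu⟩ := h
  rw [intertwine_iff] at hu
  let a : ∀ k, A.X k × Fin (s k) ≃ Fin (Θ.n k) × Fin (s k) :=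
    fun k => (e k).prodCongr (Equiv.refl _)
  let b : ∀ k, Fin (Φ.n k) × Fin (t k) ≃ B.X k × Fin (t k) :=
    fun k => ((e' k).prodCongr (Equiv.refl _)).symm
  refine ⟨fun k => ⟨s k, hs k⟩, fun k => ⟨t k, ht k⟩,
    fun k => (a k).trans ((u k).trans (b k)), fun g => ?_⟩
  refine ((hu g _ _ (hA g).symm (hB g).symm).preimage a).mono fun k x hx => ?_
  by_contra hc
  simp only [Set.mem_preimage, Set.mem_ofPred_eq, not_not] at hc
  apply hx
  have e1 : a k (ampPerm _ (s k) (A.perm g k) x) =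
      ampPerm _ (s k) ((e k).permCongr (A.perm g k)) (a k x) := by
    refine Prod.ext ?_ rfl
    change e k (A.perm g k x.1) = e k (A.perm g k ((e k).symm (e k x.1)))
    rw [Equiv.symm_apply_apply]
  have e2 : ∀ y, b k (ampPerm _ (t k) ((e' k).permCongr (B.perm g k)) y) =
      ampPerm _ (t k) (B.perm g k) (b k y) := by
    intro y
    refine Prod.ext ?_ rfl
    change (e' k).symm (e' k (B.perm g k ((e' k).symm y.1))) = _
    rw [Equiv.symm_apply_apply]
    rfl
  change b k (u k (a k (ampPerm _ (s k) (A.perm g k) x))) =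
    ampPerm _ (t k) (B.perm g k) (b k (u k (a k x)))
  rw [e1, hc, e2]

theorem cls_eq_of_equiv {A B : AlmostAction ω G} {s t : ℕ → ℕ+}
    (u : ∀ k, A.X k × Fin (s k) ≃ B.X k × Fin (t k))
    (hu : ∀ g, IsNull ω fun k =>
      {x | u k (ampPerm _ _ (A.perm g k) x) ≠ ampPerm _ _ (B.perm g k) (u k x)}) : A.cls = B.cls :=
  Quotient.sound (A.presents_toRep.equivalent B.presents_toRep u hu)

theorem Presents.cls_eq {A : AlmostAction ω G} {Θ : SoficRep ω G}
    {e : ∀ k, A.X k ≃ Fin (Θ.n k)} (hA : A.Presents Θ e) : A.cls = Θ.cls :=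
  Quotient.sound (A.presents_toRep.equivalent hA (s := 1) (t := 1) (fun _ => Equiv.refl _)
    fun _ => isNull_of_forall_notMem fun _ _ hx => hx rfl)

theorem cls_ofRep (Θ : SoficRep ω G) : (ofRep Θ).cls = Θ.cls := (presents_ofRep Θ).cls_eq

/-! ### Embeddings of almost actions -/

/-- Essentially injective maps which are equivariant up to null sets. They identify `A` with the
cut of `B` by the range of the maps. -/
structure Emb (A B : AlmostAction ω G) (f : ∀ k, A.X k → B.X k) : Prop where
  essInjective : EssInjective ω f
  equivariant : ∀ g, IsNull ω fun k => {x | f k (A.perm g k x) ≠ B.perm g k (f k x)}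

theorem Emb.of_equiv {A B : AlmostAction ω G} (e : ∀ k, A.X k ≃ B.X k)
    (he : ∀ g k x, e k (A.perm g k x) = B.perm g k (e k x)) : Emb A B fun k => e k :=
  ⟨.of_equiv e, fun g => isNull_of_forall_notMem fun k x hx => hx (he g k x)⟩

theorem Emb.comp {A B C : AlmostAction ω G} {g : ∀ k, B.X k → C.X k} {f : ∀ k, A.X k → B.X k}
    (hg : Emb B C g) (hf : Emb A B f) : Emb A C fun k => g k ∘ f k := by
  refine ⟨hg.essInjective.comp hf.essInjective, fun a => ?_⟩
  refine ((hf.equivariant a).union (hf.essInjective.isNull_preimage (hg.equivariant a))).mono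
    fun k x hx => ?_
  by_contra hc
  simp only [Set.mem_union, Set.mem_preimage, Set.mem_ofPred_eq, not_or, not_not] at hc
  exact hx (by simp only [Function.comp_apply, hc.1, hc.2])

theorem Emb.amp {A B : AlmostAction ω G} {f : ∀ k, A.X k → B.X k} (hf : Emb A B f)
    (r : ℕ → ℕ+) : Emb (A.amp r) (B.amp r) fun k => Prod.map (f k) id := by
  obtain ⟨⟨⟨D, hD, hinj⟩, C, hC, hle⟩, he⟩ := hf
  refine ⟨⟨⟨fun k => Prod.fst ⁻¹' D k, hD.preimage_fst, fun k x hx y hy hxy => ?_⟩, C, hC, ?_⟩,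
    fun g => (he g).preimage_fst.mono fun k x hx h => hx (Prod.ext h rfl)⟩
  · exact Prod.ext (hinj k hx hy (congrArg Prod.fst hxy)) (congrArg Prod.snd hxy :)
  · filter_upwards [hle] with k hk
    rw [card_amp, card_amp, Nat.cast_mul, Nat.cast_mul, ← mul_assoc]
    gcongr

theorem Emb.amp_mul (A : AlmostAction ω G) (r s : ℕ → ℕ+) :
    ∃ f, Emb ((A.amp r).amp s) (A.amp (r * s)) f :=
  ⟨_, .of_equiv (fun k => (Equiv.prodAssoc (A.X k) (Fin (r k)) (Fin (s k))).trans
    ((Equiv.refl _).prodCongr finProdFinEquiv)) fun _ _ _ => rfl⟩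

theorem Emb.amp_mul_symm (A : AlmostAction ω G) (r s : ℕ → ℕ+) :
    ∃ f, Emb (A.amp (r * s)) ((A.amp r).amp s) f :=
  ⟨_, .of_equiv (fun k => (((Equiv.prodAssoc (A.X k) (Fin (r k)) (Fin (s k))).trans
    ((Equiv.refl _).prodCongr finProdFinEquiv)).symm :
      A.X k × Fin (r k * s k) ≃ (A.X k × Fin (r k)) × Fin (s k))) fun _ _ _ => rfl⟩

theorem Emb.amp_comm (A : AlmostAction ω G) (r s : ℕ → ℕ+) :
    ∃ f, Emb ((A.amp r).amp s) ((A.amp s).amp r) f :=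
  ⟨_, .of_equiv (fun k => (Equiv.prodAssoc (A.X k) (Fin (r k)) (Fin (s k))).trans
    (((Equiv.refl _).prodCongr (Equiv.prodComm _ _)).trans (Equiv.prodAssoc _ _ _).symm))
    fun _ _ _ => rfl⟩

/-- Embeddings into a common almost action factor through each other as soon as the ranges are
almost contained in each other. -/
theorem Emb.exists_factor {A B C : AlmostAction ω G} {f : ∀ k, A.X k → C.X k}
    {g : ∀ k, B.X k → C.X k} (hf : Emb A C f) (hg : Emb B C g)
    (hfg : IsNull ω fun k => f k ⁻¹' (Set.range (g k))ᶜ) : ∃ h, Emb A B h := by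
  let h : ∀ k, A.X k → B.X k := fun k => Function.invFun (g k) ∘ f k
  have hh : ∀ k x, f k x ∈ Set.range (g k) → g k (h k x) = f k x := fun k x hx =>
    Function.invFun_eq hx
  have hinj : EssInjective ω h := hf.essInjective.of_comp hg.essInjective
    (hfg.mono fun k x hx hc => hx (hh k x hc))
  refine ⟨h, hinj, fun a => ?_⟩
  obtain ⟨⟨D, hD, hDinj⟩, -⟩ := hg.essInjective
  have hD' := hinj.isNull_preimage hD
  refine ((((hfg.preimage fun k => A.perm a k).union hfg).union
    ((hf.equivariant a).union (hinj.isNull_preimage (hg.equivariant a)))).union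
    ((hD'.preimage fun k => A.perm a k).union
      (hinj.isNull_preimage (hD.preimage fun k => B.perm a k)))).mono fun k x hx => ?_
  by_contra hc
  simp only [Set.mem_union, Set.mem_preimage, Set.mem_ofPred_eq, Set.mem_compl_iff, not_or,
    not_not] at hc
  obtain ⟨⟨⟨h1, h2⟩, h3, h4⟩, h5, h6⟩ := hc
  refine hx (hDinj k h5 h6 ?_)
  rw [hh k _ h1, h4, hh k _ h2, h3]

/-- An embedding whose range has null complement is an equivalence. After amplifying by the
cardinalities of the two spaces the dimensions agree and the embedding extends to a bijection. -/
theorem cls_eq_of_emb {A B : AlmostAction ω G} {f : ∀ k, A.X k → B.X k} (hf : Emb A B f)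
    (hr : IsNull ω fun k => (Set.range (f k))ᶜ) : A.cls = B.cls := by
  classical
  obtain ⟨⟨⟨D, hD, hinj⟩, -⟩, he⟩ := hf
  let s : ℕ → ℕ+ := fun k => ⟨Nat.card (B.X k), Nat.card_pos⟩
  let t : ℕ → ℕ+ := fun k => ⟨Nat.card (A.X k), Nat.card_pos⟩
  let F : ∀ k, A.X k × Fin (s k) → B.X k × Fin (t k) := fun k x =>
    (f k x.1, if h : x.2.1 < t k then ⟨x.2.1, h⟩ else ⟨0, (t k).pos⟩)
  let E : ∀ k, Set (A.X k × Fin (s k)) := fun k => {x | x.1 ∈ D k ∧ x.2.1 < t k}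
  have hFinj : ∀ k, (E k).InjOn (F k) := by
    rintro k ⟨x, i⟩ hx ⟨y, j⟩ hy hxy
    have h1 : x = y := hinj k hx.1 hy.1 (congrArg Prod.fst hxy)
    have h2 := congrArg Prod.snd hxy
    have hx2 : i.1 < t k := hx.2
    have hy2 : j.1 < t k := hy.2
    simp only [F, hx2, hy2, dif_pos, Fin.mk.injEq] at h2
    exact Prod.ext h1 (Fin.ext h2)
  have hE : IsNull ω fun k => (E k)ᶜ := by
    have h2 : IsNull ω fun k => {x : A.X k × Fin (s k) | ¬ x.2.1 < t k} := by
      refine squeeze_zero (fun _ => density_nonneg _) (fun k => ?_) hr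
      have h3 : {x : A.X k × Fin (s k) | ¬ x.2.1 < t k} =
          Equiv.prodComm _ _ ⁻¹' (Prod.fst ⁻¹' {i : Fin (s k) | ¬ i.1 < t k}) := rfl
      dsimp only
      rw [h3]
      refine (density_preimage _ _).le.trans ((density_preimage_fst_le _).trans ?_)
      have hB : Nat.card (B.X k) ≤ Nat.card (A.X k) + ((Set.range (f k))ᶜ).ncard := by
        rw [← Set.ncard_add_ncard_compl (Set.range (f k)), ← Set.image_univ]
        gcongr
        exact (Set.ncard_image_le (Set.toFinite _)).trans (Set.ncard_univ _).le
      have h4 : {i : Fin (s k) | ¬ i.1 < t k}.ncard ≤ ((Set.range (f k))ᶜ).ncard := by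
        have h5 : {i : Fin (s k) | ¬ i.1 < t k}.ncard ≤
            (Set.Ico (Nat.card (A.X k)) (Nat.card (B.X k))).ncard :=
          Set.ncard_le_ncard_of_injOn Fin.val (fun i hi => ⟨not_lt.1 hi, i.2⟩)
            Fin.val_injective.injOn
        rw [Set.ncard_eq_toFinset_card' (Set.Ico _ _), Set.toFinset_Ico, Nat.card_Ico] at h5
        omega
      rw [density, density, Nat.card_fin]
      change _ / (Nat.card (B.X k) : ℝ) ≤ _
      gcongr
    refine (hD.preimage_fst.union h2).mono fun k x hx => ?_
    by_contra hc
    exact hx ⟨not_not.1 fun h => hc (Or.inl h), not_not.1 fun h => hc (Or.inr h)⟩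
  have hu : ∀ k, ∃ u : A.X k × Fin (s k) ≃ B.X k × Fin (t k), ∀ x ∈ E k, u x = F k x := by
    intro k
    let _ := Fintype.ofFinite (A.X k × Fin (s k))
    let _ := Fintype.ofFinite (B.X k × Fin (t k))
    have hcard : Fintype.card (A.X k × Fin (s k)) = (Finset.univ : Finset (B.X k × Fin (t k))).card := by
      rw [Finset.card_univ, Fintype.card_eq_nat_card, Fintype.card_eq_nat_card, Nat.card_prod,
        Nat.card_prod, Nat.card_fin, Nat.card_fin]
      exact mul_comm _ _
    obtain ⟨u, hu⟩ := Set.MapsTo.exists_equiv_extend_of_card_eq hcard (s := E k) (f := F k)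
      (fun _ _ => by simp) (hFinj k)
    exact ⟨u.trans (Equiv.subtypeUnivEquiv (by simp)), hu⟩
  choose u hu using hu
  refine cls_eq_of_equiv u fun g => ?_
  refine ((hE.union (hE.preimage fun k => ampPerm _ _ (A.perm g k))).union
    (he g).preimage_fst).mono fun k x hx => ?_
  by_contra hc
  simp only [Set.mem_union, Set.mem_preimage, Set.mem_ofPred_eq, Set.mem_compl_iff, not_or,
    not_not] at hc
  obtain ⟨⟨h1, h2⟩, h3⟩ := hc
  apply hx
  rw [hu k _ h1, hu k _ h2]
  exact Prod.ext h3 rfl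

theorem cls_amp (A : AlmostAction ω G) (r : ℕ → ℕ+) : (A.amp r).cls = A.cls :=
  haveI : Unique (Fin ((1 : ℕ+) : ℕ)) := inferInstanceAs (Unique (Fin 1))
  cls_eq_of_equiv (s := fun _ => 1) (t := r)
    (fun k => (Equiv.prodUnique (A.X k × Fin (r k)) (Fin ((1 : ℕ+) : ℕ)) :))
    fun _ => isNull_of_forall_notMem fun _ _ hx => hx rfl

/-! ### The order induced by embeddings of amplifications -/

/-- `A` is, up to amplification, a cut of an amplification of `B`. -/
def Sub (A B : AlmostAction ω G) : Prop :=
  ∃ (s r : ℕ → ℕ+) (f : _), Emb (A.amp s) (B.amp r) f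

theorem Emb.sub {A B : AlmostAction ω G} {f : ∀ k, A.X k → B.X k} (hf : Emb A B f) : Sub A B :=
  ⟨1, 1, _, hf.amp 1⟩

theorem Sub.trans {A B C : AlmostAction ω G} (h : Sub A B) (h' : Sub B C) : Sub A C := by
  obtain ⟨s, r, f, hf⟩ := h
  obtain ⟨s', r', f', hf'⟩ := h'
  obtain ⟨_, h1⟩ := Emb.amp_mul_symm A s s'
  obtain ⟨_, h2⟩ := Emb.amp_comm B r s'
  obtain ⟨_, h3⟩ := Emb.amp_mul C r' r
  exact ⟨s * s', r' * r, _, h3.comp ((hf'.amp r).comp (h2.comp ((hf.amp s').comp h1)))⟩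

theorem sub_of_cls_eq {A B : AlmostAction ω G} (h : A.cls = B.cls) : Sub A B := by
  obtain ⟨s, t, u, hu⟩ := A.presents_toRep.exists_of_equivalent B.presents_toRep
    (Quotient.exact h)
  exact ⟨s, t, fun k => u k, .of_equiv u, hu⟩

end AlmostAction

theorem mem_tail {X : ℕ → Type} {S : ℕ → ∀ k, Set (X k)} {j k : ℕ} {x : X k} :
    x ∈ tail S j k ↔ ∀ i < j, x ∉ S i k := by
  simp [tail]

namespace AlmostAction

/-! ### Cuts -/

/-- `S` is an almost invariant sequence of sets. -/
def Invariant (A : AlmostAction ω G) (S : ∀ k, Set (A.X k)) : Prop :=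
  ∀ g, IsNull ω fun k => {x | ¬ (A.perm g k x ∈ S k ↔ x ∈ S k)}

theorem commutes_hom_iff {A : AlmostAction ω G} {S : ∀ k, Set (A.X k)} :
    Commutes A.hom S ↔ A.Invariant S := by
  refine ⟨fun h g => h g _ rfl, fun h g σ hσ => ?_⟩
  refine ((h g).union (UProd.mk_eq_iff.1 hσ)).mono fun k x hx => ?_
  by_contra hc
  simp only [Set.mem_union, Set.mem_ofPred_eq, not_or, not_not] at hc
  exact hx (by rw [hc.2]; exact hc.1)

theorem Invariant.compl {A : AlmostAction ω G} {S : ∀ k, Set (A.X k)} (h : A.Invariant S) :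
    A.Invariant fun k => (S k)ᶜ :=
  fun g => (h g).mono fun _ _ hx hc => hx (not_congr hc)

theorem Invariant.inter {A : AlmostAction ω G} {S T : ∀ k, Set (A.X k)} (hS : A.Invariant S)
    (hT : A.Invariant T) : A.Invariant fun k => S k ∩ T k := fun g =>
  ((hS g).union (hT g)).mono fun k x hx => by
    by_contra hc
    simp only [Set.mem_union, Set.mem_ofPred_eq, not_or, not_not] at hc
    exact hx (and_congr hc.1 hc.2)

theorem Invariant.preimage {A B : AlmostAction ω G} {f : ∀ k, A.X k → B.X k} (hf : Emb A B f)
    {S : ∀ k, Set (B.X k)} (hS : B.Invariant S) : A.Invariant fun k => f k ⁻¹' S k := fun g =>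
  ((hf.equivariant g).union (hf.essInjective.isNull_preimage (hS g))).mono fun k x hx => by
    by_contra hc
    simp only [Set.mem_union, Set.mem_preimage, Set.mem_ofPred_eq, not_or, not_not] at hc
    refine hx ?_
    rw [Set.mem_preimage, hc.1]
    exact hc.2

theorem Invariant.amp {A : AlmostAction ω G} {S : ∀ k, Set (A.X k)} (hS : A.Invariant S)
    (r : ℕ → ℕ+) : (A.amp r).Invariant fun k => Prod.fst ⁻¹' S k :=
  fun g => (hS g).preimage_fst

theorem Invariant.tail {A : AlmostAction ω G} {S : ℕ → ∀ k, Set (A.X k)}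
    (hS : ∀ i, A.Invariant (S i)) (j : ℕ) : A.Invariant (tail S j) := by
  induction j with
  | zero => exact fun g => isNull_of_forall_notMem fun k x hx => hx (by simp [mem_tail])
  | succ j ih =>
    have h : SoficSpace.tail S (j + 1) = fun k => SoficSpace.tail S j k ∩ (S j k)ᶜ := by
      funext k
      ext x
      simp [mem_tail, le_iff_lt_or_eq, or_imp, forall_and]
    rw [h]
    exact ih.inter (hS j).compl

/-- An embedding of `B` in `A` whose range is `S` up to a null sequence of sets: `B` is a version
of the cut of `A` by `S`. -/
structure EmbOnto (B A : AlmostAction ω G) (S : ∀ k, Set (A.X k)) (f : ∀ k, B.X k → A.X k) :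
    Prop extends Emb B A f where
  preimage_compl : IsNull ω fun k => f k ⁻¹' (S k)ᶜ
  diff_range : IsNull ω fun k => S k \ Set.range (f k)

theorem Emb.onto_range {A B : AlmostAction ω G} {f : ∀ k, B.X k → A.X k} (hf : Emb B A f) :
    EmbOnto B A (fun k => Set.range (f k)) f :=
  ⟨hf, isNull_of_forall_notMem fun _ x hx => hx ⟨x, rfl⟩,
    isNull_of_forall_notMem fun _ _ hx => hx.2 hx.1⟩

/-- The range of an embedding is almost invariant: almost all of its points stay in it, and since
each permutation preserves cardinalities, almost no point enters it from outside. -/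
theorem EmbOnto.invariant {A B : AlmostAction ω G} {S : ∀ k, Set (A.X k)}
    {f : ∀ k, B.X k → A.X k} (hf : EmbOnto B A S f) : A.Invariant S := by
  intro g
  have h1 : IsNull ω fun k => S k \ A.perm g k ⁻¹' S k := by
    refine hf.essInjective.isNull_of_preimage ?_ (hf.diff_range.mono fun k x hx => ⟨hx.1.1, hx.2⟩)
    refine ((hf.equivariant g).union (hf.preimage_compl.preimage fun k => B.perm g k)).mono
      fun k x hx => ?_
    by_contra hc
    simp only [Set.mem_union, Set.mem_preimage, Set.mem_ofPred_eq, Set.mem_compl_iff, not_or,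
      not_not] at hc
    refine hx.2 ?_
    rw [Set.mem_preimage, ← hc.1]
    exact hc.2
  have h2 : IsNull ω fun k => A.perm g k ⁻¹' S k \ S k := by
    have h3 : ∀ k, (A.perm g k ⁻¹' S k \ S k).ncard = (S k \ A.perm g k ⁻¹' S k).ncard := by
      intro k
      have h4 : (A.perm g k ⁻¹' S k).ncard = (S k).ncard := by
        rw [← Set.ncard_image_of_injective _ (A.perm g k).injective, Equiv.image_preimage]
      have h5 := Set.ncard_sdiff_add_ncard (A.perm g k ⁻¹' S k) (S k)
      have h6 := Set.ncard_sdiff_add_ncard (S k) (A.perm g k ⁻¹' S k)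
      rw [Set.union_comm] at h6
      omega
    simpa only [IsNull, density, h3] using h1
  refine (h1.union h2).mono fun k x hx => ?_
  by_contra hc
  simp only [Set.mem_union, Set.mem_sdiff, Set.mem_preimage, not_or, not_and, not_not] at hc
  exact hx ⟨hc.2, hc.1⟩

theorem EmbOnto.not_isNull {A B : AlmostAction ω G} {S : ∀ k, Set (A.X k)}
    {f : ∀ k, B.X k → A.X k} (hf : EmbOnto B A S f) : ¬ IsNull ω S := fun h =>
  not_isNull_of_compl hf.preimage_compl (hf.essInjective.isNull_preimage h)

theorem EmbOnto.comp_equiv {A B C : AlmostAction ω G} {S : ∀ k, Set (A.X k)}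
    {f : ∀ k, B.X k → A.X k} (hf : EmbOnto B A S f) {e : ∀ k, C.X k ≃ B.X k}
    (he : Emb C B fun k => e k) : EmbOnto C A S fun k => f k ∘ e k :=
  ⟨hf.toEmb.comp he, hf.preimage_compl.preimage e, by
    simpa only [EquivLike.range_comp] using hf.diff_range⟩

/-- Every almost invariant sequence of sets which is not null defines a cut. -/
theorem Invariant.exists_embOnto {A : AlmostAction ω G} {S : ∀ k, Set (A.X k)}
    (hS : A.Invariant S) (h0 : ¬ IsNull ω S) : ∃ B f, EmbOnto B A S f := by
  classical
  obtain ⟨δ, hδ, hle⟩ := exists_le_density h0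
  have hδ1 : δ ≤ 1 := by
    obtain ⟨k, hk⟩ := hle.exists
    exact hk.trans (density_le_one _)
  -- Indices at which `S` is too small form an `ω`-null set; enlarging `S` there makes all the
  -- sets nonempty and their cardinalities tend to infinity.
  let T : ∀ k, Set (A.X k) := fun k => if δ ≤ density (S k) then S k else Set.univ
  have hTS : ∀ᶠ k in (ω : Filter ℕ), T k = S k := hle.mono fun k hk => if_pos hk
  have hT : ∀ k, δ ≤ density (T k) := by
    intro k
    by_cases h : δ ≤ density (S k)
    · simpa only [T, if_pos h] using h
    · simpa only [T, if_neg h, density_univ] using hδ1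
  have hcard : ∀ k, δ * Nat.card (A.X k) ≤ Nat.card (T k) := by
    intro k
    rw [Nat.card_coe_set_eq, ← density_mul_card]
    gcongr
    exact hT k
  have hTne : ∀ k, Nonempty (T k) := by
    intro k
    rw [Set.nonempty_coe_sort, Set.nonempty_iff_ne_empty]
    intro h
    have := hT k
    rw [h, density, Set.ncard_empty] at this
    simp only [Nat.cast_zero, zero_div] at this
    linarith
  -- The partial injections of `T k` induced by the `perm g k` extend to permutations.
  have hext : ∀ g k, ∃ τ : Equiv.Perm (T k), ∀ x : T k, A.perm g k x ∈ T k →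
      (τ x : A.X k) = A.perm g k x := by
    intro g k
    let _ := Fintype.ofFinite (T k)
    let F : T k → T k := fun x => if h : A.perm g k x ∈ T k then ⟨A.perm g k x, h⟩ else x
    obtain ⟨u, hu⟩ := Set.MapsTo.exists_equiv_extend_of_card_eq
      (t := (Finset.univ : Finset (T k))) Finset.card_univ.symm (s := {x | A.perm g k x ∈ T k})
      (f := F) (fun _ _ => by simp) (by
        intro x hx y hy hxy
        simp only [Set.mem_ofPred_eq] at hx hy
        simp only [F, dif_pos hx, dif_pos hy, Subtype.mk.injEq, EmbeddingLike.apply_eq_iff_eq]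
          at hxy
        exact Subtype.ext hxy)
    refine ⟨u.trans (Equiv.subtypeUnivEquiv (by simp)), fun x hx => ?_⟩
    have h1 : (u x : T k) = F x := hu x hx
    change ((u x : T k) : A.X k) = _
    rw [h1]
    simp only [F, dif_pos hx]
  choose τ hτ using hext
  have hval : EssInjective ω fun k (x : T k) => (x : A.X k) :=
    .of_injective (fun k => Subtype.val_injective) (inv_pos.2 hδ) (Eventually.of_forall fun k => by
      rw [inv_mul_eq_div, le_div_iff₀ hδ, mul_comm]
      exact hcard k)
  have hM : ∀ g, IsNull ω fun k => {x : T k | A.perm g k x ∉ T k} := by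
    intro g
    refine (hval.isNull_preimage (hS g)).mono_eventually (hTS.mono fun k hk x hx => ?_)
    change ¬ (_ ↔ _)
    rw [← hk]
    exact fun h => hx (h.2 x.2)
  refine ⟨{ X := fun k => T k
            finite := fun _ => inferInstance
            nonempty := hTne
            tendsto_card := ?_
            perm := τ
            mul := fun g h => ?_
            free := fun g hg => ?_ }, fun k x => x, ⟨hval, fun g => ?_⟩, ?_, ?_⟩
  · rw [← tendsto_natCast_atTop_iff (R := ℝ)]
    exact tendsto_atTop_mono hcard
      ((tendsto_natCast_atTop_iff.2 A.tendsto_card).const_mul_atTop hδ)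
  · refine (((hM (g * h)).union (hM h)).union (((hM g).preimage (τ h)).union
      (hval.isNull_preimage (A.mul g h)))).mono fun k x hx => ?_
    by_contra hc
    simp only [Set.mem_union, Set.mem_preimage, Set.mem_ofPred_eq, not_or, not_not] at hc
    obtain ⟨⟨h1, h2⟩, h3, h4⟩ := hc
    refine hx (Subtype.ext ?_)
    rw [hτ _ _ _ h1, hτ _ _ _ h3, hτ _ _ _ h2, h4]
  · refine ((hM g).union (hval.isNull_preimage (A.free g hg))).mono fun k x hx => ?_
    by_contra hc
    simp only [Set.mem_union, Set.mem_preimage, Set.mem_ofPred_eq, not_or, not_not] at hc hx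
    refine hc.2 ?_
    rw [← hτ _ _ _ hc.1, hx]
  · refine (hM g).mono fun k x hx hc => hx (hτ _ _ _ hc)
  · refine isNull_empty.mono_eventually (hTS.mono fun k hk x hx => hx ?_)
    rw [← hk]
    exact x.2
  · refine isNull_empty.mono_eventually (hTS.mono fun k hk x hx => hx.2 ?_)
    rw [Subtype.range_coe, hk]
    exact hx.1

theorem Presents.emb {A : AlmostAction ω G} {Θ : SoficRep ω G} {e : ∀ k, A.X k ≃ Fin (Θ.n k)}
    (hA : A.Presents Θ e) : Emb A (ofRep Θ) fun k => e k := by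
  refine ⟨.of_equiv e, fun g => ?_⟩
  have h := UProd.mk_eq_iff.1 ((hA g).symm.trans (mk_repPerm Θ g).symm)
  refine (h.preimage e).mono fun k x hx hc => hx ?_
  rw [Equiv.permCongr_apply, Equiv.symm_apply_apply] at hc
  exact hc

theorem Presents.emb_symm {A : AlmostAction ω G} {Θ : SoficRep ω G}
    {e : ∀ k, A.X k ≃ Fin (Θ.n k)} (hA : A.Presents Θ e) :
    Emb (ofRep Θ) A fun k => (e k).symm := by
  refine ⟨.of_equiv fun k => (e k).symm, fun g => ?_⟩
  refine IsNull.mono (UProd.mk_eq_iff.1 ((mk_repPerm Θ g).trans (hA g))) fun k x hx hc => hx ?_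
  have hc' : repPerm Θ g k x = e k (A.perm g k ((e k).symm x)) := hc
  change (e k).symm (repPerm Θ g k x) = _
  rw [hc', Equiv.symm_apply_apply]

theorem exists_embOnto_of_isCut {A : AlmostAction ω G} {S : ∀ k, Set (A.X k)} {Φ : SoficRep ω G}
    (h : IsCut A.hom S Φ) : ∃ f, EmbOnto (ofRep Φ) A S f := by
  obtain ⟨h0, -, e, hsrc, htgt, he⟩ := h
  have htgt0 : ¬ IsNull ω fun k => (e k).target := fun hn => h0 <|
    (hn.union htgt).mono fun k x hx => by
      by_cases hxt : x ∈ (e k).target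
      · exact Or.inl hxt
      · exact Or.inr (Or.inr ⟨hx, hxt⟩)
  obtain ⟨δ, hδ, hle⟩ := exists_le_density htgt0
  have hinj : EssInjective ω (Y := (ofRep Φ).X) fun k => e k := by
    refine ⟨⟨fun k => (e k).source, hsrc, fun k => (e k).injOn⟩, δ⁻¹, inv_pos.2 hδ, ?_⟩
    refine hle.mono fun k hk => ?_
    rw [inv_mul_eq_div, le_div_iff₀ hδ]
    have h1 : (e k).target.ncard ≤ Nat.card ((ofRep Φ).X k) := by
      rw [← (e k).image_source_eq_target, (e k).injOn.ncard_image]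
      exact Set.ncard_le_card (α := Fin (Φ.n k)) _
    calc (Nat.card (A.X k) : ℝ) * δ ≤ Nat.card (A.X k) * density (e k).target := by gcongr
      _ = (e k).target.ncard := by rw [mul_comm, density_mul_card]
      _ ≤ _ := by exact_mod_cast h1
  refine ⟨fun k => e k, ⟨hinj, fun g => ?_⟩, ?_, ?_⟩
  · refine IsNull.mono (he g _ _ rfl (mk_repPerm Φ g)) fun k x hx hc => hx hc.2.2
  · refine (hsrc.union (hinj.isNull_preimage htgt)).mono fun k x hx => ?_
    by_cases h1 : x ∈ (e k).source
    · exact Or.inr (Or.inl ⟨(e k).map_source h1, hx⟩)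
    · exact Or.inl h1
  · refine htgt.mono fun k x hx => Or.inr ⟨hx.1, fun h1 => hx.2 ?_⟩
    exact ⟨_, (e k).right_inv h1⟩

theorem EmbOnto.isCut {A : AlmostAction ω G} {S : ∀ k, Set (A.X k)} {Φ : SoficRep ω G}
    {f : ∀ k, (ofRep Φ).X k → A.X k} (hf : EmbOnto (ofRep Φ) A S f) : IsCut A.hom S Φ := by
  obtain ⟨⟨D, hD, hinj⟩, -⟩ := hf.essInjective
  have : ∀ k, Nonempty (Fin (Φ.n k)) := (ofRep Φ).nonempty
  refine ⟨hf.not_isNull, commutes_hom_iff.2 hf.invariant,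
    fun k => (hinj k).bijOn_image.toPartialEquiv, hD, ?_, ?_⟩
  · refine ((hf.essInjective.isNull_image hf.preimage_compl).union (hf.diff_range.union
      (hf.essInjective.isNull_image hD))).mono fun k x hx => ?_
    rcases hx with ⟨⟨y, hy, rfl⟩, hx⟩ | ⟨hx, hx'⟩
    · exact Or.inl ⟨y, hx, rfl⟩
    · by_cases h : x ∈ Set.range (f k)
      · obtain ⟨y, rfl⟩ := h
        exact Or.inr (Or.inr ⟨y, fun hy => hx' ⟨y, hy, rfl⟩, rfl⟩)
      · exact Or.inr (Or.inl ⟨hx, h⟩)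
  · intro g σ φ hσ hφ
    have h1 : IsNull ω fun k => {x | σ k x ≠ A.perm g k x} := UProd.mk_eq_iff.1 hσ
    have h2 : IsNull ω fun k => {x | φ k x ≠ repPerm Φ g k x} :=
      UProd.mk_eq_iff.1 (hφ.trans (mk_repPerm Φ g).symm)
    refine ((hD.union (hD.preimage φ)).union ((hf.essInjective.isNull_preimage h1).union
      (h2.union (hf.equivariant g)))).mono fun k x hx => ?_
    by_contra hc
    refine hx ⟨not_not.1 fun h => hc (Or.inl (Or.inl h)),
      not_not.1 fun h => hc (Or.inl (Or.inr h)), ?_⟩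
    have h5 : σ k (f k x) = A.perm g k (f k x) := not_not.1 fun h => hc (Or.inr (Or.inl h))
    have h6 : φ k x = repPerm Φ g k x := not_not.1 fun h => hc (Or.inr (Or.inr (Or.inl h)))
    change f k (φ k x) = σ k (f k x)
    rw [h5, h6]
    exact not_not.1 fun h => hc (Or.inr (Or.inr (Or.inr h)))

theorem EmbOnto.isCut_toRep {A B : AlmostAction ω G} {S : ∀ k, Set (A.X k)}
    {f : ∀ k, B.X k → A.X k} (hf : EmbOnto B A S f) : IsCut A.hom S B.toRep :=
  (hf.comp_equiv B.presents_toRep.emb_symm).isCut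

/-- `F_{[Θ]}` consists of the classes below `Θ` in the order `Sub`. -/
theorem cls_mem_faceOf {A : AlmostAction ω G} {Θ : SoficRep ω G} :
    A.cls ∈ faceOf Θ ↔ Sub A (ofRep Θ) := by
  constructor
  · rintro ⟨r, hr, S, Φ, hcut, hΦ⟩
    rw [← hom_ofRep Θ] at hcut
    obtain ⟨f, hf⟩ := exists_embOnto_of_isCut (A := (ofRep Θ).amp fun k => ⟨r k, hr k⟩) hcut
    exact (sub_of_cls_eq (hΦ.symm.trans (cls_ofRep Φ).symm)).trans
      (hf.toEmb.sub.trans (sub_of_cls_eq (cls_amp _ _)))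
  · rintro ⟨s, r, f, hf⟩
    refine ⟨fun k => r k, fun k => (r k).pos, fun k => Set.range (f k), (A.amp s).toRep, ?_, A.cls_amp s⟩
    rw [← hom_ofRep Θ]
    exact hf.onto_range.isCut_toRep

end AlmostAction

/-! ### Direct sums and convex combinations -/

theorem IsNull.of_sum {X Y : ℕ → Type} [∀ k, Finite (X k)] [∀ k, Finite (Y k)]
    {N : ∀ k, Set (X k ⊕ Y k)} (hX : IsNull ω fun k => Sum.inl ⁻¹' N k)
    (hY : IsNull ω fun k => Sum.inr ⁻¹' N k) : IsNull ω N := by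
  refine squeeze_zero (fun _ => density_nonneg _) (fun k => ?_) (by simpa using Tendsto.add hX hY)
  have h : N k = Sum.inl '' (Sum.inl ⁻¹' N k) ∪ Sum.inr '' (Sum.inr ⁻¹' N k) := by
    ext (x | x) <;> simp
  calc density (N k) ≤ _ := (congrArg density h).le.trans (density_union_le _ _)
    _ ≤ _ := add_le_add (density_image_le _ Sum.inl_injective _)
      (density_image_le _ Sum.inr_injective _)

theorem conj_mk {X Y : ℕ → Type} [∀ k, Finite (X k)] [∀ k, Finite (Y k)] (u : ∀ k, X k ≃ Y k)
    (σ : ∀ k, Equiv.Perm (X k)) :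
    conj ω u (UProd.mk ω σ) = UProd.mk ω fun k => (u k).permCongr (σ k) := rfl

theorem amp_mk {X : ℕ → Type} [∀ k, Finite (X k)] (r : ℕ → ℕ) (σ : ∀ k, Equiv.Perm (X k)) :
    amp ω X r (UProd.mk ω σ) = UProd.mk ω fun k => ampPerm (X k) (r k) (σ k) := rfl

theorem dsum_mk {X Y : ℕ → Type} [∀ k, Finite (X k)] [∀ k, Finite (Y k)]
    (σ : ∀ k, Equiv.Perm (X k)) (τ : ∀ k, Equiv.Perm (Y k)) :
    dsum ω X Y (UProd.mk ω σ, UProd.mk ω τ) =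
      UProd.mk ω fun k => Equiv.sumCongr (σ k) (τ k) := by
  change UProd.mk ω _ = UProd.mk ω _
  congr 1
  funext k
  ext (x | y) <;> rfl

namespace AlmostAction

/-- The direct sum of two almost actions. -/
def sum (A B : AlmostAction ω G) : AlmostAction ω G where
  X k := A.X k ⊕ B.X k
  finite _ := inferInstance
  nonempty _ := inferInstance
  tendsto_card := by
    refine tendsto_atTop_mono (fun k => ?_) A.tendsto_card
    rw [Nat.card_sum]
    exact Nat.le_add_right _ _
  perm g k := Equiv.sumCongr (A.perm g k) (B.perm g k)
  mul g h := .of_sum ((A.mul g h).mono fun k x hx hc => hx (congrArg Sum.inl hc))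
    ((B.mul g h).mono fun k x hx hc => hx (congrArg Sum.inr hc))
  free g hg := .of_sum ((A.free g hg).mono fun k x hx => Sum.inl_injective hx)
    ((B.free g hg).mono fun k x hx => Sum.inr_injective hx)

theorem card_sum (A B : AlmostAction ω G) (k : ℕ) :
    (Nat.card ((A.sum B).X k) : ℝ) = Nat.card (A.X k) + Nat.card (B.X k) := by
  change (Nat.card (A.X k ⊕ B.X k) : ℝ) = _
  rw [Nat.card_sum, Nat.cast_add]

theorem Emb.inl {A B : AlmostAction ω G} {C : ℝ} (hC : 0 < C)
    (h : ∀ᶠ k in (ω : Filter ℕ), (Nat.card (B.X k) : ℝ) ≤ C * Nat.card (A.X k)) :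
    Emb A (A.sum B) fun _ => Sum.inl :=
  ⟨.of_injective (fun _ => Sum.inl_injective) (add_pos one_pos hC) (h.mono fun k hk => by
    rw [card_sum]; linarith), fun _ => isNull_of_forall_notMem fun _ _ hx => hx rfl⟩

theorem Emb.inr {A B : AlmostAction ω G} {C : ℝ} (hC : 0 < C)
    (h : ∀ᶠ k in (ω : Filter ℕ), (Nat.card (A.X k) : ℝ) ≤ C * Nat.card (B.X k)) :
    Emb B (A.sum B) fun _ => Sum.inr :=
  ⟨.of_injective (fun _ => Sum.inr_injective) (add_pos one_pos hC) (h.mono fun k hk => by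
    rw [card_sum]; linarith), fun _ => isNull_of_forall_notMem fun _ _ hx => hx rfl⟩

theorem Emb.sumMap {A B C D : AlmostAction ω G} {f : ∀ k, A.X k → C.X k}
    {g : ∀ k, B.X k → D.X k} (hf : Emb A C f) (hg : Emb B D g) :
    Emb (A.sum B) (C.sum D) fun k => Sum.map (f k) (g k) := by
  obtain ⟨⟨⟨E, hE, hinj⟩, a, ha, hle⟩, he⟩ := hf
  obtain ⟨⟨⟨E', hE', hinj'⟩, a', ha', hle'⟩, he'⟩ := hg
  refine ⟨⟨⟨fun k => Sum.elim (· ∈ E k) (· ∈ E' k), .of_sum hE hE', fun k => ?_⟩, a + a',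
    by positivity, ?_⟩, fun g => .of_sum ((he g).mono fun k x hx hc => hx (congrArg Sum.inl hc))
      ((he' g).mono fun k x hx hc => hx (congrArg Sum.inr hc))⟩
  · rintro (x | x) hx (y | y) hy hxy
    · exact congrArg Sum.inl (hinj k hx hy (Sum.inl_injective hxy))
    · exact absurd hxy Sum.inl_ne_inr
    · exact absurd hxy Sum.inr_ne_inl
    · exact congrArg Sum.inr (hinj' k hx hy (Sum.inr_injective hxy))
  · filter_upwards [hle, hle'] with k h h'
    rw [card_sum, card_sum]
    have h1 : (0 : ℝ) ≤ Nat.card (A.X k) := Nat.cast_nonneg _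
    have h2 : (0 : ℝ) ≤ Nat.card (B.X k) := Nat.cast_nonneg _
    nlinarith

theorem Emb.sumElim {A B C : AlmostAction ω G} {f : ∀ k, A.X k → C.X k} {g : ∀ k, B.X k → C.X k}
    (hf : Emb A C f) (hg : Emb B C g) (hfg : IsNull ω fun k => g k ⁻¹' Set.range (f k)) :
    Emb (A.sum B) C fun k => Sum.elim (f k) (g k) := by
  obtain ⟨⟨⟨E, hE, hinj⟩, a, ha, hle⟩, he⟩ := hf
  obtain ⟨⟨⟨E', hE', hinj'⟩, -⟩, he'⟩ := hg
  refine ⟨⟨⟨fun k => Sum.elim (· ∈ E k) (fun y => y ∈ E' k ∧ g k y ∉ Set.range (f k)),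
    .of_sum hE ((hE'.union hfg).mono fun k x hx => ?_), fun k => ?_⟩, a, ha, ?_⟩,
    fun g => .of_sum (he g) (he' g)⟩
  · by_contra hc
    exact hx ⟨not_not.1 fun h => hc (Or.inl h), fun h => hc (Or.inr h)⟩
  · rintro (x | x) hx (y | y) hy hxy
    · exact congrArg Sum.inl (hinj k hx hy hxy)
    · exact absurd ⟨x, hxy⟩ hy.2
    · exact absurd ⟨y, hxy.symm⟩ hx.2
    · exact congrArg Sum.inr (hinj' k hx.1 hy.1 hxy)
  · filter_upwards [hle] with k h
    rw [card_sum]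
    have h2 : (0 : ℝ) ≤ Nat.card (B.X k) := Nat.cast_nonneg _
    nlinarith

theorem Emb.sum_amp (A B : AlmostAction ω G) (r : ℕ → ℕ+) :
    ∃ f, Emb ((A.sum B).amp r) ((A.amp r).sum (B.amp r)) f :=
  ⟨_, .of_equiv (fun k => Equiv.sumProdDistrib (A.X k) (B.X k) (Fin (r k)))
    (by rintro g k ⟨x | x, i⟩ <;> rfl)⟩

theorem Emb.amp_add (A : AlmostAction ω G) (r s : ℕ → ℕ+) :
    ∃ f, Emb ((A.amp r).sum (A.amp s)) (A.amp (r + s)) f :=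
  ⟨_, .of_equiv (fun k => ((Equiv.prodSumDistrib (A.X k) (Fin (r k)) (Fin (s k))).symm.trans
    ((Equiv.refl _).prodCongr finSumFinEquiv) :
      (A.X k × Fin (r k)) ⊕ (A.X k × Fin (s k)) ≃ A.X k × Fin (r k + s k)))
    (by rintro g k (x | x) <;> rfl)⟩

/-- The two cuts are placed in complementary summands of an amplification of `C`, after amplifying
by the multiplicities of each other. -/
theorem Sub.sum {A B C : AlmostAction ω G} (hA : Sub A C) (hB : Sub B C) : Sub (A.sum B) C := by
  obtain ⟨s, r, f, hf⟩ := hA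
  obtain ⟨s', r', f', hf'⟩ := hB
  obtain ⟨_, h1⟩ := Emb.sum_amp A B (s * s')
  obtain ⟨_, h2⟩ := Emb.amp_mul_symm A s s'
  obtain ⟨_, h3⟩ : ∃ f, Emb (B.amp (s * s')) ((B.amp s').amp s) f :=
    mul_comm s' s ▸ Emb.amp_mul_symm B s' s
  obtain ⟨_, h4⟩ := Emb.amp_mul C r s'
  obtain ⟨_, h5⟩ := Emb.amp_mul C r' s
  obtain ⟨_, h6⟩ := Emb.amp_add C (r * s') (r' * s)
  exact ⟨s * s', r * s' + r' * s, _, h6.comp (((h4.comp ((hf.amp s').comp h2)).sumMap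
    (h5.comp ((hf'.amp s).comp h3))).comp h1)⟩

theorem isConvComb_sum (A B : AlmostAction ω G) {c : ℝ}
    (h : Tendsto (fun k => (Nat.card (A.X k) : ℝ) / (Nat.card (A.X k) + Nat.card (B.X k)))
      (ω : Filter ℕ) (𝓝 c)) : IsConvComb c A.cls B.cls (A.sum B).cls := by
  let v : ∀ k, (Fin (Nat.card (A.X k)) × Fin 1) ⊕ (Fin (Nat.card (B.X k)) × Fin 1) ≃ A.X k ⊕ B.X k :=
    fun k => Equiv.sumCongr ((Equiv.prodUnique _ (Fin 1)).trans (Finite.equivFin (A.X k)).symm)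
      ((Equiv.prodUnique _ (Fin 1)).trans (Finite.equivFin (B.X k)).symm)
  let e : ∀ k, A.X k ⊕ B.X k ≃ Fin (Nat.card (A.X k ⊕ B.X k)) := fun k => Finite.equivFin _
  refine ⟨A.toRep, B.toRep, (A.sum B).toRep, rfl, rfl, rfl, fun _ => 1, fun _ => 1,
    fun _ => one_pos, fun _ => one_pos, ?_, fun k => (v k).trans (e k), ?_⟩
  · simp only [mul_one, Nat.cast_add]
    exact h
  · ext g
    simp only [MonoidHom.comp_apply, MonoidHom.prod_apply]
    change conj ω e (UProd.mk ω fun k => Equiv.sumCongr (A.perm g k) (B.perm g k)) =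
      conj ω (fun k => (v k).trans (e k))
        (dsum ω (fun k => Fin (Nat.card (A.X k)) × Fin 1) (fun k => Fin (Nat.card (B.X k)) × Fin 1)
          (SoficSpace.amp ω (fun k => Fin (Nat.card (A.X k))) (fun _ => 1)
            (conj ω (fun k => Finite.equivFin (A.X k)) (UProd.mk ω (A.perm g))),
          SoficSpace.amp ω (fun k => Fin (Nat.card (B.X k))) (fun _ => 1)
            (conj ω (fun k => Finite.equivFin (B.X k)) (UProd.mk ω (B.perm g)))))
    rw [conj_mk, conj_mk, conj_mk, amp_mk, amp_mk, dsum_mk, conj_mk]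
    refine UProd.mk_eq_iff.2 (isNull_of_forall_notMem fun k x hx => hx ?_)
    obtain ⟨w, rfl⟩ := ((v k).trans (e k)).surjective x
    rw [Equiv.permCongr_apply, Equiv.permCongr_apply, Equiv.symm_apply_apply]
    change e k (Equiv.sumCongr (A.perm g k) (B.perm g k) ((e k).symm (e k (v k w)))) = _
    rw [Equiv.symm_apply_apply]
    refine congrArg (e k) ?_
    obtain ⟨a, i⟩ | ⟨a, i⟩ := w
    · exact congrArg Sum.inl ((Finite.equivFin (A.X k)).symm_apply_apply _).symm
    · exact congrArg Sum.inr ((Finite.equivFin (B.X k)).symm_apply_apply _).symm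

theorem exists_sum_of_isConvComb {c : ℝ} {x y z : Sof ω G} (h : IsConvComb c x y z) :
    ∃ A B : AlmostAction ω G, A.cls = x ∧ B.cls = y ∧ (A.sum B).cls = z ∧
      Tendsto (fun k => (Nat.card (A.X k) : ℝ) / (Nat.card (A.X k) + Nat.card (B.X k)))
        (ω : Filter ℕ) (𝓝 c) := by
  obtain ⟨Θ₁, Θ₂, Φ, rfl, rfl, rfl, r, t, hr, ht, hc, u, hu⟩ := h
  let A : AlmostAction ω G := (ofRep Θ₁).amp fun k => ⟨r k, hr k⟩
  let B : AlmostAction ω G := (ofRep Θ₂).amp fun k => ⟨t k, ht k⟩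
  have hP : (A.sum B).Presents Φ u := by
    intro g
    rw [hu]
    simp only [MonoidHom.comp_apply, MonoidHom.prod_apply, ← mk_repPerm]
    rw [amp_mk, amp_mk, dsum_mk, conj_mk]
    rfl
  refine ⟨A, B, (cls_amp _ _).trans (cls_ofRep _), (cls_amp _ _).trans (cls_ofRep _), hP.cls_eq, ?_⟩
  have h1 : ∀ k, (Nat.card (A.X k) : ℝ) = (Θ₁.n k * r k : ℕ) := fun k => by
    congr 1
    exact (card_amp _ _ _).trans (congrArg (· * r k) (Nat.card_fin _))
  have h2 : ∀ k, (Nat.card (B.X k) : ℝ) = (Θ₂.n k * t k : ℕ) := fun k => by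
    congr 1
    exact (card_amp _ _ _).trans (congrArg (· * t k) (Nat.card_fin _))
  simpa only [h1, h2, ← Nat.cast_add] using hc

/-- In a nontrivial convex combination both summands are cuts. -/
theorem sub_sum_of_tendsto {A B : AlmostAction ω G} {c : ℝ} (hc0 : 0 < c) (hc1 : c < 1)
    (h : Tendsto (fun k => (Nat.card (A.X k) : ℝ) / (Nat.card (A.X k) + Nat.card (B.X k)))
      (ω : Filter ℕ) (𝓝 c)) : Sub A (A.sum B) ∧ Sub B (A.sum B) := by
  have hA : ∀ k, (0 : ℝ) < Nat.card (A.X k) := fun k => by exact_mod_cast Nat.card_pos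
  have hB : ∀ k, (0 : ℝ) < Nat.card (B.X k) := fun k => by exact_mod_cast Nat.card_pos
  refine ⟨(Emb.inl (C := 2 / c) (by positivity) ?_).sub,
    (Emb.inr (C := 2 / (1 - c)) (div_pos two_pos (by linarith)) ?_).sub⟩
  · filter_upwards [h.eventually (eventually_ge_nhds (half_lt_self hc0))] with k hk
    rw [le_div_iff₀ (add_pos (hA k) (hB k))] at hk
    rw [div_mul_eq_mul_div, le_div_iff₀ hc0]
    nlinarith [hA k, hB k]
  · have h1 : c < (1 + c) / 2 := by linarith
    filter_upwards [h.eventually (eventually_le_nhds h1)] with k hk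
    rw [div_le_iff₀ (add_pos (hA k) (hB k))] at hk
    rw [div_mul_eq_mul_div, le_div_iff₀ (by linarith)]
    nlinarith [hA k, hB k]

theorem isFace_faceOf (Θ : SoficRep ω G) : IsFace (faceOf Θ) where
  nonempty := ⟨_, cls_mem_faceOf.2 (sub_of_cls_eq (A := ofRep Θ) rfl)⟩
  convex := by
    intro c _ _ x hx y hy z h
    obtain ⟨A, B, rfl, rfl, rfl, -⟩ := exists_sum_of_isConvComb h
    exact cls_mem_faceOf.2 ((cls_mem_faceOf.1 hx).sum (cls_mem_faceOf.1 hy))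
  mem_of_convComb := by
    intro c hc0 hc1 x y z h hz
    obtain ⟨A, B, rfl, rfl, rfl, hlim⟩ := exists_sum_of_isConvComb h
    obtain ⟨h1, h2⟩ := sub_sum_of_tendsto hc0 hc1 hlim
    exact ⟨cls_mem_faceOf.2 (h1.trans (cls_mem_faceOf.1 hz)),
      cls_mem_faceOf.2 (h2.trans (cls_mem_faceOf.1 hz))⟩

/-- All the cuts of an extreme point are equivalent to it. -/
theorem Sub.cls_eq_of_isExtreme {A B : AlmostAction ω G} (h : Sub A B) (hB : IsExtreme B.cls) :
    A.cls = B.cls := by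
  obtain ⟨s, r, f, hf⟩ := h
  rw [← cls_amp A s]
  rw [← cls_amp B r] at hB ⊢
  generalize A.amp s = A at f hf ⊢
  generalize B.amp r = B at f hf hB ⊢
  -- If the complement of the range is not null, it is cut out and `B` becomes a direct sum.
  by_cases hr : IsNull ω fun k => (Set.range (f k))ᶜ
  · exact cls_eq_of_emb hf hr
  obtain ⟨A', f', hf'⟩ := hf.onto_range.invariant.compl.exists_embOnto hr
  have hsum := hf.sumElim hf'.toEmb (by simpa only [compl_compl] using hf'.preimage_compl)
  have hcls : (A.sum A').cls = B.cls := cls_eq_of_emb hsum <| hf'.diff_range.mono fun k x hx =>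
    ⟨fun ⟨y, hy⟩ => hx ⟨Sum.inl y, hy⟩, fun ⟨y, hy⟩ => hx ⟨Sum.inr y, hy⟩⟩
  have hA : ∀ k, (0 : ℝ) < Nat.card (A.X k) := fun k => by exact_mod_cast Nat.card_pos
  have hA' : ∀ k, (0 : ℝ) < Nat.card (A'.X k) := fun k => by exact_mod_cast Nat.card_pos
  -- The proportion of `A` in the direct sum is the trace of the first summand.
  have hlim := tendsto_tr ω fun k => (Set.range Sum.inl : Set (A.X k ⊕ A'.X k))
  have hd : ∀ k, density (Set.range Sum.inl : Set (A.X k ⊕ A'.X k)) =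
      (Nat.card (A.X k) : ℝ) / (Nat.card (A.X k) + Nat.card (A'.X k)) := by
    intro k
    rw [density, ← Set.image_univ, Set.ncard_image_of_injective _ Sum.inl_injective,
      Set.ncard_univ, Nat.card_sum, Nat.cast_add]
  simp only [hd] at hlim
  obtain ⟨C, hC, hle⟩ := hf.essInjective.card_le
  obtain ⟨C', hC', hle'⟩ := hf'.essInjective.card_le
  -- Neither summand is negligible, so the proportion lies strictly between `0` and `1`.
  have h0 : (1 + 2 * C)⁻¹ ≤ tr ω fun k => (Set.range Sum.inl : Set (A.X k ⊕ A'.X k)) := by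
    refine ge_of_tendsto hlim ?_
    filter_upwards [hle, hf'.essInjective.card_le_two_mul] with k h1 h2
    rw [inv_eq_one_div, div_le_div_iff₀ (by positivity) (add_pos (hA k) (hA' k))]
    nlinarith
  have h1 : tr ω (fun k => (Set.range Sum.inl : Set (A.X k ⊕ A'.X k))) ≤ 1 - (1 + 2 * C')⁻¹ := by
    refine le_of_tendsto hlim ?_
    filter_upwards [hle', hf.essInjective.card_le_two_mul] with k h1 h2
    rw [div_le_iff₀ (add_pos (hA k) (hA' k)), sub_mul, one_mul, le_sub_iff_add_le,
      ← le_sub_iff_add_le', add_sub_cancel_left, inv_mul_le_iff₀ (by positivity)]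
    nlinarith
  rw [← hcls] at hB ⊢
  exact (hB _ (lt_of_lt_of_le (by positivity) h0)
    (lt_of_le_of_lt h1 (sub_lt_self _ (by positivity))) _ _ (isConvComb_sum A A' hlim)).1

end AlmostAction

/-! ### Decompositions into infinitely many cuts -/

theorem density_tail {X : ℕ → Type} [∀ k, Finite (X k)] [∀ k, Nonempty (X k)]
    {S : ℕ → ∀ k, Set (X k)} {k : ℕ} (hS : ∀ i j, i ≠ j → Disjoint (S i k) (S j k)) (m : ℕ) :
    density (tail S m k) = 1 - ∑ i ∈ Finset.range m, density (S i k) := by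
  have h : density (⋃ i ∈ Finset.range m, S i k) = ∑ i ∈ Finset.range m, density (S i k) := by
    induction m with
    | zero => simp [density]
    | succ m ih =>
      rw [Finset.sum_range_succ, ← ih, Finset.range_add_one, Finset.set_biUnion_insert,
        Set.union_comm, density, density, density, ← add_div, ← Nat.cast_add,
        Set.ncard_union_eq ?_ (Set.toFinite _) (Set.toFinite _)]
      simp only [Set.disjoint_iUnion_left, Finset.mem_range]
      exact fun i hi => hS i m hi.ne
  rw [tail, density_compl, h]

namespace AlmostAction

theorem EmbOnto.exists_emb {A B C : AlmostAction ω G} {S T : ∀ k, Set (C.X k)}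
    {f : ∀ k, A.X k → C.X k} {g : ∀ k, B.X k → C.X k} (hf : EmbOnto A C S f)
    (hg : EmbOnto B C T g) (h : IsNull ω fun k => S k \ T k) : ∃ u, Emb A B u := by
  refine hf.toEmb.exists_factor hg.toEmb ((hf.preimage_compl.union
    ((hf.essInjective.isNull_preimage h).union
      (hf.essInjective.isNull_preimage hg.diff_range))).mono fun k x hx => ?_)
  by_contra hc
  simp only [Set.mem_union, Set.mem_preimage, Set.mem_compl_iff, Set.mem_sdiff, not_or, not_and,
    not_not] at hc hx
  exact hx (hc.2.2 (hc.2.1 hc.1))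

theorem EmbOnto.equiv_comp {A B C : AlmostAction ω G} {S : ∀ k, Set (B.X k)}
    {f : ∀ k, A.X k → B.X k} (hf : EmbOnto A B S f) {e : ∀ k, B.X k ≃ C.X k}
    (he : Emb B C fun k => e k) :
    EmbOnto A C (fun k => (e k).symm ⁻¹' S k) fun k => e k ∘ f k := by
  refine ⟨he.comp hf.toEmb, hf.preimage_compl.mono fun k x hx => ?_,
    (hf.diff_range.preimage fun k => (e k).symm).mono fun k x hx => ⟨hx.1, fun ⟨y, hy⟩ => hx.2 ?_⟩⟩
  · simpa using hx
  · exact ⟨y, (Equiv.eq_symm_apply _).1 hy⟩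

/-- If `A` decomposes as the infinite direct sum of its cuts `Θ i`, then every `C` below the
`j`-th tail has a common cut with one of the `Θ i`, `i ≥ j`: otherwise `C` would be negligible. -/
theorem exists_common_cut {A B C : AlmostAction ω G} {Θ : ℕ → AlmostAction ω G}
    {S : ℕ → ∀ k, Set (A.X k)}
    (hS : ∀ ε > 0, ∃ m, ∀ᶠ k in (ω : Filter ℕ), density (tail S m k) ≤ ε)
    {e : ∀ i k, (Θ i).X k → A.X k} (he : ∀ i, EmbOnto (Θ i) A (S i) (e i)) {j : ℕ}
    {f : ∀ k, B.X k → A.X k} (hf : EmbOnto B A (tail S j) f) (hC : Sub C B) :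
    ∃ i, j ≤ i ∧ ∃ Λ, Sub Λ C ∧ Sub Λ (Θ i) := by
  obtain ⟨s, r, g, hg⟩ := hC
  have hF := (hf.toEmb.amp r).comp hg
  set F : ∀ k, (C.amp s).X k → (A.amp r).X k := fun k => Prod.map (f k) id ∘ g k with hFdef
  let T : ℕ → ∀ k, Set ((C.amp s).X k) := fun i k => F k ⁻¹' (Prod.fst ⁻¹' S i k)
  obtain ⟨i, hi⟩ : ∃ i, ¬ IsNull ω (T i) := by
    by_contra! hT
    refine not_isNull_univ (isNull_of_forall_inter (S := T) (fun ε hε => ?_) fun i => by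
      simpa only [Set.univ_inter] using hT i)
    obtain ⟨D, hD, a, ha, hle⟩ := hF.essInjective.exists_density_preimage_le
    obtain ⟨m, hm⟩ := hS (ε / 2 / a) (by positivity)
    refine ⟨m, ?_⟩
    filter_upwards [hle, hm, hD.eventually (eventually_le_nhds (half_pos hε))] with k h1 h2 h3
    have h4 : tail T m k = F k ⁻¹' (Prod.fst ⁻¹' tail S m k) :=
      Set.ext fun y => mem_tail.trans (mem_tail (x := (F k y).1)).symm
    rw [h4]
    calc _ ≤ _ := h1 _
      _ ≤ ε / 2 + a * (ε / 2 / a) := by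
        gcongr
        exact (density_preimage_fst_le _).trans h2
      _ = ε := by field_simp; ring
  have hij : j ≤ i := by
    by_contra! hij
    refine hi ((hg.essInjective.isNull_preimage
      (hf.preimage_compl.preimage_fst (Y := fun k => Fin (r k)))).mono fun k x hx => ?_)
    exact fun hc => mem_tail.1 hc i hij hx
  obtain ⟨Λ, h, hh⟩ := (((he i).invariant.amp r).preimage hF).exists_embOnto hi
  have hFh := hF.comp hh.toEmb
  obtain ⟨u, hu⟩ := hFh.exists_factor ((he i).toEmb.amp r) (by
    refine (hh.preimage_compl.union (hFh.essInjective.isNull_preimage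
      ((he i).diff_range.preimage_fst (Y := fun k => Fin (r k))))).mono fun k x hx => ?_
    by_contra hc
    have h1 : h k x ∈ T i k := not_not.1 fun h' => hc (Or.inl h')
    obtain ⟨y, hy⟩ : (F k (h k x)).1 ∈ Set.range (e i k) :=
      not_not.1 fun h' => hc (Or.inr ⟨h1, h'⟩)
    exact hx ⟨(y, _), Prod.ext hy rfl⟩)
  exact ⟨i, hij, Λ, hh.toEmb.sub.trans (sub_of_cls_eq (cls_amp _ _)),
    hu.sub.trans (sub_of_cls_eq (cls_amp _ _))⟩

end AlmostAction

open AlmostAction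

theorem IsInfConvComb.exists_density_tail_le {c : ℕ → ℝ} {x : ℕ → Sof ω G} {Ψ : SoficRep ω G}
    {S : ℕ → ∀ k, Set (Fin (Ψ.n k))} (h : IsInfConvComb c x Ψ S) {ε : ℝ} (hε : 0 < ε) :
    ∃ m, ∀ᶠ k in (ω : Filter ℕ), density (tail S m k) ≤ ε := by
  obtain ⟨m, hm⟩ := (h.sum_eq_one.eventually (eventually_lt_nhds hε)).exists
  exact ⟨m, (tendsto_tr ω (tail S m)).eventually (eventually_le_nhds hm)⟩

theorem IsInfConvComb.exists_embOnto {c : ℕ → ℝ} {x : ℕ → Sof ω G} {Ψ : SoficRep ω G}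
    {S : ℕ → ∀ k, Set (Fin (Ψ.n k))} (h : IsInfConvComb c x Ψ S) (i : ℕ) :
    ∃ (Θ : AlmostAction ω G) (f : _), EmbOnto Θ (ofRep Ψ) (S i) f ∧ Θ.cls = x i := by
  obtain ⟨Θ, hΘ, hx⟩ := h.cut_eq i
  rw [← hom_ofRep Ψ] at hΘ
  obtain ⟨f, hf⟩ := exists_embOnto_of_isCut hΘ
  exact ⟨_, f, hf, (cls_ofRep Θ).trans hx⟩

/-- Tails are defined as complements of the earlier pieces, so that this uses orthogonality. -/
theorem IsInfConvComb.isNull_diff_tail {c : ℕ → ℝ} {x : ℕ → Sof ω G} {Ψ : SoficRep ω G}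
    {S : ℕ → ∀ k, Set (Fin (Ψ.n k))} (h : IsInfConvComb c x Ψ S) {i j : ℕ} (hij : j ≤ i) :
    IsNull ω fun k => S i k \ tail S j k := by
  induction j with
  | zero => exact isNull_of_forall_notMem fun k x hx => hx.2 (mem_tail.2 (by simp))
  | succ j ih =>
    refine ((ih (Nat.le_of_succ_le hij)).union
      (h.orthogonal i j (Nat.lt_of_succ_le hij).ne')).mono fun k x hx => ?_
    obtain ⟨h1, h2⟩ := hx
    rw [mem_tail] at h2
    push Not at h2
    obtain ⟨a, ha, hxa⟩ := h2
    rcases Nat.lt_succ_iff_lt_or_eq.1 ha with ha | rfl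
    · exact Or.inl ⟨h1, fun h3 => mem_tail.1 h3 a ha hxa⟩
    · exact Or.inr ⟨h1, hxa⟩

/-- The tail is not null because it almost contains the piece `S j`. -/
theorem IsInfConvComb.exists_isCut_tail {c : ℕ → ℝ} {x : ℕ → Sof ω G} {Ψ : SoficRep ω G}
    {S : ℕ → ∀ k, Set (Fin (Ψ.n k))} (h : IsInfConvComb c x Ψ S) (j : ℕ) :
    ∃ Φ, IsCut Ψ.hom (tail S j) Φ := by
  choose Θ f hf _ using h.exists_embOnto
  have hinv : (ofRep Ψ).Invariant (tail S j) := Invariant.tail (fun i => (hf i).invariant) j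
  obtain ⟨B, g, hg⟩ := hinv.exists_embOnto fun h0 => (hf j).not_isNull <|
    (h0.union (h.isNull_diff_tail le_rfl)).mono fun k y hy => by
      by_cases hy' : y ∈ tail S j k
      · exact Or.inl hy'
      · exact Or.inr ⟨hy, hy'⟩
  exact ⟨B.toRep, hom_ofRep Ψ ▸ hg.isCut_toRep⟩

section
variable {c : ℕ → ℝ} {x : ℕ → Sof ω G} {Ψ : SoficRep ω G} {S : ℕ → ∀ k, Set (Fin (Ψ.n k))}
  (h : IsInfConvComb c x Ψ S) {Φ : ℕ → SoficRep ω G} (hΦ : ∀ j, IsCut Ψ.hom (tail S j) (Φ j))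
include h hΦ

/-- The `j`-th piece is contained in the `j`-th tail. -/
theorem IsInfConvComb.sub_tail (j : ℕ) {A : AlmostAction ω G} (hA : A.cls = x j) :
    Sub A (ofRep (Φ j)) := by
  obtain ⟨Θ, f, hf, hΘ⟩ := h.exists_embOnto j
  have hΦj := hΦ j
  rw [← hom_ofRep Ψ] at hΦj
  obtain ⟨g, hg⟩ := exists_embOnto_of_isCut hΦj
  obtain ⟨u, hu⟩ := hf.exists_emb hg (h.isNull_diff_tail le_rfl)
  exact (sub_of_cls_eq (hA.trans hΘ.symm)).trans hu.sub

/-- Every representation below the `j`-th tail has one of the `x i`, `i ≥ j`, as a cut. -/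
theorem IsInfConvComb.exists_sub (hext : ∀ i, IsExtreme (x i)) {j : ℕ} {C : AlmostAction ω G}
    (hC : Sub C (ofRep (Φ j))) : ∃ i, j ≤ i ∧ ∃ Λ : AlmostAction ω G, Sub Λ C ∧ Λ.cls = x i := by
  choose Θ f hf hΘ using h.exists_embOnto
  have hΦj := hΦ j
  rw [← hom_ofRep Ψ] at hΦj
  obtain ⟨g, hg⟩ := exists_embOnto_of_isCut hΦj
  obtain ⟨i, hij, Λ, h1, h2⟩ := exists_common_cut (A := ofRep Ψ) (S := S)
    (fun ε hε => h.exists_density_tail_le hε) hf hg hC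
  exact ⟨i, hij, Λ, h1, (h2.cls_eq_of_isExtreme (by rw [hΘ]; exact hext i)).trans (hΘ i)⟩

/-- The extreme point `x i` is not a cut of the tails beyond `i`: its common cut with some `x m`,
`m > i`, would be equivalent to both. -/
theorem IsInfConvComb.not_sub_tail (hx : Function.Injective x) (hext : ∀ i, IsExtreme (x i))
    {i j : ℕ} (hij : i < j) {A : AlmostAction ω G} (hA : A.cls = x i) :
    ¬ Sub A (ofRep (Φ j)) := by
  intro hsub
  obtain ⟨m, hm, Λ, h1, h2⟩ := h.exists_sub hΦ hext hsub
  have h3 : x m = x i := h2.symm.trans ((h1.cls_eq_of_isExtreme (by rw [hA]; exact hext i)).trans hA)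
  exact absurd (hx h3) (by omega)

theorem IsInfConvComb.strictAnti_faceOf (hx : Function.Injective x)
    (hext : ∀ i, IsExtreme (x i)) : StrictAnti fun j => faceOf (Φ j) := by
  refine strictAnti_nat_of_succ_lt fun j => ⟨fun z hz => ?_, fun hle => ?_⟩
  · obtain ⟨Z, rfl⟩ := Quotient.exists_rep z
    have hΦj := hΦ j
    have hΦj' := hΦ (j + 1)
    rw [← hom_ofRep Ψ] at hΦj hΦj'
    obtain ⟨g, hg⟩ := exists_embOnto_of_isCut hΦj
    obtain ⟨g', hg'⟩ := exists_embOnto_of_isCut hΦj'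
    obtain ⟨u, hu⟩ := hg'.exists_emb hg (isNull_of_forall_notMem fun k y hy => by
      exact hy.2 (mem_tail.2 fun i hi => mem_tail.1 hy.1 i (hi.trans j.lt_succ_self)))
    change Z.cls ∈ faceOf (Φ (j + 1)) at hz
    change Z.cls ∈ faceOf (Φ j)
    rw [← cls_ofRep Z, cls_mem_faceOf] at hz ⊢
    exact hz.trans hu.sub
  · obtain ⟨Θ, -, -, hΘ⟩ := h.exists_embOnto j
    exact h.not_sub_tail hΦ hx hext j.lt_succ_self hΘ
      (cls_mem_faceOf.1 (hle (cls_mem_faceOf.2 (h.sub_tail hΦ j hΘ))))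

theorem IsInfConvComb.iInter_faceOf (hx : Function.Injective x)
    (hext : ∀ i, IsExtreme (x i)) : ⋂ j, faceOf (Φ j) = ∅ := by
  refine Set.eq_empty_of_forall_notMem fun z hz => ?_
  obtain ⟨Z, rfl⟩ := Quotient.exists_rep z
  have hZ : ∀ j, Sub (ofRep Z) (ofRep (Φ j)) := fun j => by
    rw [← cls_mem_faceOf, cls_ofRep]
    exact Set.mem_iInter.1 hz j
  obtain ⟨i, -, Λ, h1, h2⟩ := h.exists_sub hΦ hext (hZ 0)
  exact h.not_sub_tail hΦ hx hext i.lt_succ_self h2 (h1.trans (hZ (i + 1)))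

end

/-! ### Infinite direct sums -/

section
/-- The `k`-th stage of an infinite disjoint union: the first `k + 1` blocks. -/
abbrev Blocks (X : ℕ → ℕ → Type) (k : ℕ) : Type := Σ i : Fin (k + 1), X i k

/-- The `i`-th block, which is empty at the stages `k < i`. -/
def block (X : ℕ → ℕ → Type) (i k : ℕ) : Set (Blocks X k) := {y | (y.1 : ℕ) = i}

variable {X : ℕ → ℕ → Type}

theorem blocks_mk_injective {i k : ℕ} (h : i < k + 1) :
    Function.Injective fun x : X i k => (⟨⟨i, h⟩, x⟩ : Blocks X k) :=
  sigma_mk_injective (β := fun i : Fin (k + 1) => X i k) (i := ⟨i, h⟩)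

theorem block_eq_range {i k : ℕ} (h : i < k + 1) :
    block X i k = Set.range fun x : X i k => (⟨⟨i, h⟩, x⟩ : Blocks X k) := by
  ext ⟨⟨a, ha⟩, y⟩
  constructor
  · intro h'
    obtain rfl : a = i := h'
    exact ⟨y, rfl⟩
  · rintro ⟨z, hz⟩
    have := congrArg (fun y => (y.1 : ℕ)) hz
    exact this.symm

theorem disjoint_block {i j : ℕ} (h : i ≠ j) (k : ℕ) : Disjoint (block X i k) (block X j k) :=
  Set.disjoint_left.2 fun _ hx hy => h (hx.symm.trans hy)

variable [∀ i k, Finite (X i k)]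

theorem card_blocks (k : ℕ) :
    (Nat.card (Blocks X k) : ℝ) = ∑ i ∈ Finset.range (k + 1), (Nat.card (X i k) : ℝ) := by
  rw [Nat.card_sigma, Nat.cast_sum, Finset.sum_range]

theorem density_block {i k : ℕ} (h : i < k + 1) :
    density (block X i k) =
      (Nat.card (X i k) : ℝ) / ∑ j ∈ Finset.range (k + 1), (Nat.card (X j k) : ℝ) := by
  rw [density, card_blocks, block_eq_range h, ← Set.image_univ,
    Set.ncard_image_of_injective _ (blocks_mk_injective h), Set.ncard_univ]

variable [∀ i k, Nonempty (X i k)]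

instance blocks_nonempty (k : ℕ) : Nonempty (Blocks X k) := ⟨⟨0, Classical.arbitrary _⟩⟩

variable {c : ℕ → ℝ} (hc : HasSum c 1)
  (hw : ∀ i, Tendsto (fun k => density (block X i k)) (ω : Filter ℕ) (𝓝 (c i)))

include hw in
theorem tendsto_density_tail_block (m : ℕ) :
    Tendsto (fun k => density (tail (block X) m k)) (ω : Filter ℕ)
      (𝓝 (1 - ∑ i ∈ Finset.range m, c i)) := by
  have h : ∀ k, density (tail (block X) m k) =
      1 - ∑ i ∈ Finset.range m, density (block X i k) := fun k =>
    density_tail (fun i j hij => disjoint_block hij k) m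
  simp only [h]
  exact (tendsto_finsetSum _ fun i _ => hw i).const_sub 1

include hc hw in
/-- No mass escapes to the blocks of large index, so null sets can be detected on each block. -/
theorem IsNull.of_blocks {N : ∀ k, Set (Blocks X k)}
    (hN : ∀ i, IsNull ω fun k => {x : X i k | ∃ h : i < k + 1, (⟨⟨i, h⟩, x⟩ : Blocks X k) ∈ N k}) :
    IsNull ω N := by
  refine isNull_of_forall_inter (S := block X) (fun ε hε => ?_) fun i => ?_
  · have h0 : Tendsto (fun m => 1 - ∑ i ∈ Finset.range m, c i) atTop (𝓝 0) := by
      simpa using hc.tendsto_sum_nat.const_sub 1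
    obtain ⟨m, hm⟩ := (h0.eventually (eventually_lt_nhds hε)).exists
    exact ⟨m, (tendsto_density_tail_block hw m).eventually (eventually_le_nhds hm)⟩
  · refine squeeze_zero (fun _ => density_nonneg _) (fun k => ?_) (hN i)
    by_cases h : i < k + 1
    · refine le_trans (density_mono ?_) (density_image_le
        _ (blocks_mk_injective h) _)
      rintro y ⟨hy, hy'⟩
      rw [block_eq_range h] at hy'
      obtain ⟨z, rfl⟩ := hy'
      exact ⟨z, ⟨h, hy⟩, rfl⟩
    · have : N k ∩ block X i k = ∅ := Set.eq_empty_of_forall_notMem fun y hy =>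
        h (by have := y.1.2; have h' : (y.1 : ℕ) = i := hy.2; omega)
      dsimp only
      rw [this, density, Set.ncard_empty, Nat.cast_zero, zero_div]
      exact density_nonneg _

end

namespace AlmostAction

/-- The infinite direct sum of the `A i`, with blocks in proportions tending to `c i`. -/
theorem exists_blocks (hω : (ω : Filter ℕ) ≤ cofinite) (A : ℕ → AlmostAction ω G) {c : ℕ → ℝ}
    (hc0 : ∀ i, 0 < c i) (hc : HasSum c 1)
    (hw : ∀ i, Tendsto (fun k => density (block (fun i => (A i).X) i k)) (ω : Filter ℕ)
      (𝓝 (c i))) :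
    ∃ (B : AlmostAction ω G) (u : ∀ k, Blocks (fun i => (A i).X) k ≃ B.X k), ∀ i,
      ∃ f, EmbOnto (A i) B (fun k => (u k).symm ⁻¹' block (fun i => (A i).X) i k) f := by
  have hlt : ∀ i, ∀ᶠ k in (ω : Filter ℕ), i < k + 1 := fun i => by
    have h : ∀ᶠ k in atTop, i < k + 1 := (eventually_ge_atTop i).mono fun k hk =>
      Nat.lt_succ_of_le hk
    exact (Nat.cofinite_eq_atTop ▸ hω) h
  let B : AlmostAction ω G :=
    { X := Blocks fun i => (A i).X
      finite := fun _ => inferInstance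
      nonempty := fun k => blocks_nonempty k
      tendsto_card := by
        refine tendsto_atTop_mono (fun k => ?_) (A 0).tendsto_card
        exact Nat.card_le_card_of_injective
          (Sigma.mk (β := fun i : Fin (k + 1) => (A i).X k) 0) sigma_mk_injective
      perm := fun g k => Equiv.sigmaCongrRight fun i => (A i).perm g k
      mul := fun g h => IsNull.of_blocks hc hw fun i =>
        ((A i).mul g h).mono fun k x ⟨h, hx⟩ hc => hx (Sigma.ext rfl (heq_of_eq hc))
      free := fun g hg => IsNull.of_blocks hc hw fun i =>
        ((A i).free g hg).mono fun k x ⟨h, hx⟩ => blocks_mk_injective (X := fun i => (A i).X) h hx }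
  refine ⟨B, fun k => Equiv.refl _, fun i => ?_⟩
  let f : ∀ k, (A i).X k → B.X k := fun k x =>
    if h : i < k + 1 then ⟨⟨i, h⟩, x⟩ else (B.nonempty k).some
  have hf : ∀ k (h : i < k + 1) x, f k x = ⟨⟨i, h⟩, x⟩ := fun k h x => dif_pos h
  refine ⟨f, ⟨⟨⟨fun k => {x | i < k + 1}, ?_, fun k x hx y hy hxy => ?_⟩, 2 / c i,
    div_pos two_pos (hc0 i), ?_⟩, fun g => ?_⟩, ?_, ?_⟩
  · exact isNull_empty.mono_eventually ((hlt i).mono fun k hk x hx => hx hk)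
  · rw [hf k hx, hf k hx] at hxy
    exact blocks_mk_injective (X := fun i => (A i).X) hx hxy
  · filter_upwards [hlt i, (hw i).eventually (eventually_ge_nhds (half_lt_self (hc0 i)))]
      with k h1 h2
    have := B.nonempty k
    have hpos : (0 : ℝ) < Nat.card (B.X k) := by exact_mod_cast Nat.card_pos
    rw [density_block h1, ← card_blocks, le_div_iff₀ hpos] at h2
    rw [div_mul_eq_mul_div, le_div_iff₀ (hc0 i)]
    linarith
  · refine isNull_empty.mono_eventually ((hlt i).mono fun k hk x hx => hx ?_)
    rw [hf k hk, hf k hk]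
    rfl
  · refine isNull_empty.mono_eventually ((hlt i).mono fun k hk x hx => hx ?_)
    rw [hf k hk]
    rfl
  · refine isNull_empty.mono_eventually ((hlt i).mono fun k hk x hx => hx.2 ?_)
    have hx' : x ∈ block (fun i => (A i).X) i k := hx.1
    rw [block_eq_range hk] at hx'
    obtain ⟨y, rfl⟩ := hx'
    exact ⟨y, hf k hk y⟩

end AlmostAction

/-! ### Prescribed proportions -/

/-- Rounding up the multiples `c i * (k + 1) ^ 2` yields integral weights on `{0, …, k}` whose
proportions converge to `c`: the total rounding error `k + 1` is negligible. -/
theorem tendsto_ceil_div_sum_ceil {c : ℕ → ℝ} (hc0 : ∀ i, 0 < c i) (hc : HasSum c 1) (i : ℕ) :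
    Tendsto (fun k : ℕ => (⌈c i * ((k + 1 : ℕ) ^ 2 : ℝ)⌉₊ : ℝ) /
      ∑ j ∈ Finset.range (k + 1), (⌈c j * ((k + 1 : ℕ) ^ 2 : ℝ)⌉₊ : ℝ)) atTop (𝓝 (c i)) := by
  have hM : Tendsto (fun k : ℕ => (((k + 1 : ℕ) : ℝ) ^ 2)) atTop atTop :=
    (tendsto_pow_atTop two_ne_zero).comp
      (tendsto_natCast_atTop_atTop.comp (tendsto_add_atTop_nat 1))
  have hpos : ∀ k : ℕ, (0 : ℝ) < ((k + 1 : ℕ) : ℝ) ^ 2 := fun k => by positivity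
  have h1 : Tendsto (fun k : ℕ => (⌈c i * ((k + 1 : ℕ) ^ 2 : ℝ)⌉₊ : ℝ) / ((k + 1 : ℕ) : ℝ) ^ 2)
      atTop (𝓝 (c i)) := (tendsto_nat_ceil_mul_div_atTop (hc0 i).le).comp hM
  have h2 : Tendsto (fun k : ℕ => (∑ j ∈ Finset.range (k + 1),
      (⌈c j * ((k + 1 : ℕ) ^ 2 : ℝ)⌉₊ : ℝ)) / ((k + 1 : ℕ) : ℝ) ^ 2) atTop (𝓝 1) := by
    have h3 := hc.tendsto_sum_nat.comp (tendsto_add_atTop_nat 1)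
    have h4 : Tendsto (fun k : ℕ => 1 + 1 / ((k : ℝ) + 1)) atTop (𝓝 1) := by
      simpa using (tendsto_one_div_add_atTop_nhds_zero_nat (𝕜 := ℝ)).const_add 1
    refine tendsto_of_tendsto_of_tendsto_of_le_of_le h3 h4 (fun k => ?_) fun k => ?_
    · rw [Function.comp_apply, le_div_iff₀ (hpos k), Finset.sum_mul]
      exact Finset.sum_le_sum fun j _ => Nat.le_ceil _
    · have h5 : ∑ j ∈ Finset.range (k + 1), (⌈c j * ((k + 1 : ℕ) ^ 2 : ℝ)⌉₊ : ℝ) ≤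
          ∑ j ∈ Finset.range (k + 1), (c j * ((k + 1 : ℕ) ^ 2 : ℝ) + 1) :=
        Finset.sum_le_sum fun j _ =>
          (Nat.ceil_lt_add_one (mul_nonneg (hc0 j).le (hpos k).le)).le
      have h6 : ∑ j ∈ Finset.range (k + 1), c j ≤ 1 :=
        sum_le_hasSum _ (fun j _ => (hc0 j).le) hc
      rw [Finset.sum_add_distrib, ← Finset.sum_mul, Finset.sum_const, Finset.card_range,
        nsmul_eq_mul, mul_one] at h5
      rw [div_le_iff₀ (hpos k)]
      have h7 : (1 + 1 / ((k : ℝ) + 1)) * ((k + 1 : ℕ) : ℝ) ^ 2 =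
          ((k + 1 : ℕ) : ℝ) ^ 2 + (k + 1 : ℕ) := by
        push_cast
        field_simp
      rw [h7]
      refine h5.trans ?_
      gcongr
      exact mul_le_of_le_one_left (hpos k).le h6
  have h8 := h1.div h2 one_ne_zero
  rw [div_one] at h8
  refine h8.congr fun k => ?_
  exact div_div_div_cancel_right₀ (hpos k).ne' _ _

/-- Amplifications of the `A i` which occupy asymptotically the proportions `c i`. At stage `k` all
dimensions are brought to the form `(∏_{j ≤ k} |A j|) * ⌈c i (k + 1) ^ 2⌉`. -/
theorem exists_amp_tendsto_density_block (hω : (ω : Filter ℕ) ≤ cofinite)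
    (A : ℕ → AlmostAction ω G) {c : ℕ → ℝ} (hc0 : ∀ i, 0 < c i) (hc : HasSum c 1) :
    ∃ r : ℕ → ℕ → ℕ+, ∀ i, Tendsto
      (fun k => density (block (fun i => ((A i).amp (r i)).X) i k)) (ω : Filter ℕ) (𝓝 (c i)) := by
  let w : ℕ → ℕ → ℕ := fun i k => ⌈c i * ((k + 1 : ℕ) ^ 2 : ℝ)⌉₊
  have hw : ∀ i k, 0 < w i k := fun i k => Nat.ceil_pos.2 (mul_pos (hc0 i) (by positivity))
  let r : ℕ → ℕ → ℕ+ := fun i k =>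
    ⟨(∏ j ∈ (Finset.range (k + 1)).erase i, Nat.card ((A j).X k)) * w i k,
      Nat.mul_pos (Finset.prod_pos fun j _ => Nat.card_pos) (hw i k)⟩
  have hcard : ∀ i k, i < k + 1 → (Nat.card (((A i).amp (r i)).X k) : ℝ) =
      (∏ j ∈ Finset.range (k + 1), (Nat.card ((A j).X k) : ℝ)) * w i k := by
    intro i k hi
    rw [card_amp]
    change ((Nat.card ((A i).X k) * ((∏ j ∈ (Finset.range (k + 1)).erase i,
      Nat.card ((A j).X k)) * w i k) : ℕ) : ℝ) = _
    rw [← mul_assoc, Finset.mul_prod_erase (Finset.range (k + 1)) (fun j => Nat.card ((A j).X k))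
      (Finset.mem_range.2 hi)]
    push_cast
    rfl
  refine ⟨r, fun i => ?_⟩
  refine Tendsto.mono_left ?_ (Nat.cofinite_eq_atTop ▸ hω)
  refine (tendsto_ceil_div_sum_ceil hc0 hc i).congr' ?_
  filter_upwards [eventually_ge_atTop i] with k hk
  have hi : i < k + 1 := Nat.lt_succ_of_le hk
  rw [density_block hi, hcard i k hi, Finset.sum_congr rfl fun j hj =>
    hcard j k (Finset.mem_range.1 hj), ← Finset.mul_sum, mul_div_mul_left]
  exact (Finset.prod_pos fun j _ => by exact_mod_cast Nat.card_pos).ne'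

theorem exists_isInfConvComb (hω : (ω : Filter ℕ) ≤ cofinite) (x : ℕ → Sof ω G) {c : ℕ → ℝ}
    (hc0 : ∀ i, 0 < c i) (hc : HasSum c 1) :
    ∃ (Ψ : SoficRep ω G) (S : ℕ → ∀ k, Set (Fin (Ψ.n k))), IsInfConvComb c x Ψ S := by
  have hx : ∀ i, ∃ A : AlmostAction ω G, A.cls = x i := fun i => by
    obtain ⟨Θ, hΘ⟩ := Quotient.exists_rep (x i)
    exact ⟨ofRep Θ, (cls_ofRep Θ).trans hΘ⟩
  choose A hA using hx
  obtain ⟨r, hr⟩ := exists_amp_tendsto_density_block hω A hc0 hc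
  obtain ⟨B, u, hB⟩ := exists_blocks hω (fun i => (A i).amp (r i)) hc0 hc hr
  let e : ∀ k, Blocks (fun i => ((A i).amp (r i)).X) k ≃ Fin (B.toRep.n k) := fun k =>
    (u k).trans (Finite.equivFin (B.X k))
  refine ⟨B.toRep, fun i k => (e k).symm ⁻¹' block (fun i => ((A i).amp (r i)).X) i k, ?_⟩
  have htail : ∀ j, tail (fun i k => (e k).symm ⁻¹' block (fun i => ((A i).amp (r i)).X) i k) j =
      fun k => (e k).symm ⁻¹' tail (block fun i => ((A i).amp (r i)).X) j k := fun j =>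
    funext fun k => Set.ext fun y => mem_tail.trans (mem_tail
      (S := block fun i => ((A i).amp (r i)).X) (x := (e k).symm y)).symm
  refine ⟨fun i j hij => isNull_of_forall_notMem fun k y hy =>
    Set.disjoint_left.1 (disjoint_block hij k) hy.1 hy.2, fun i => tr_eq_of_tendsto ?_, ?_,
    fun i => ⟨((A i).amp (r i)).toRep, ?_, (cls_amp _ _).trans (hA i)⟩⟩
  · simp only [density_preimage]
    exact hr i
  · have htr : ∀ j, tr ω (tail (fun i k => (e k).symm ⁻¹'
        block (fun i => ((A i).amp (r i)).X) i k) j) = 1 - ∑ i ∈ Finset.range j, c i := fun j => by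
      rw [htail]
      refine tr_eq_of_tendsto ?_
      simp only [density_preimage]
      exact tendsto_density_tail_block hr j
    simp only [htr]
    simpa using hc.tendsto_sum_nat.const_sub 1
  · obtain ⟨f, hf⟩ := hB i
    rw [← hom_ofRep B.toRep]
    exact (hf.equiv_comp B.presents_toRep.emb).isCut_toRep

end

end SoficSpace

theorem mainTheorem2 {G : Type*} [Group G] [Countable G]
    (ω : Ultrafilter ℕ) (hω : (ω : Filter ℕ) ≤ Filter.cofinite)
    (x : ℕ → SoficSpace.Sof ω G) (hx : Function.Injective x)
    (hext : ∀ i, SoficSpace.IsExtreme (x i))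
    (c : ℕ → ℝ) (hc : ∀ i, 0 < c i) (hsum : HasSum c 1) :
    (∃ (Ψ : SoficSpace.SoficRep ω G) (S : ℕ → ∀ k, Set (Fin (Ψ.n k))),
      SoficSpace.IsInfConvComb c x Ψ S) ∧
    ∀ (Ψ : SoficSpace.SoficRep ω G) (S : ℕ → ∀ k, Set (Fin (Ψ.n k))),
      SoficSpace.IsInfConvComb c x Ψ S →
      (∀ j, ∃ Φ, SoficSpace.IsCut Ψ.hom (SoficSpace.tail S j) Φ) ∧
      ∀ Φ : ℕ → SoficSpace.SoficRep ω G,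
        (∀ j, SoficSpace.IsCut Ψ.hom (SoficSpace.tail S j) (Φ j)) →
        (∀ j, SoficSpace.IsFace (SoficSpace.faceOf (Φ j))) ∧
        StrictAnti (fun j => SoficSpace.faceOf (Φ j)) ∧
        ⋂ j, SoficSpace.faceOf (Φ j) = ∅ := by
  refine ⟨SoficSpace.exists_isInfConvComb hω x hc hsum, fun Ψ S h => ⟨h.exists_isCut_tail,
    fun Φ hΦ => ⟨fun j => SoficSpace.AlmostAction.isFace_faceOf (Φ j),
      h.strictAnti_faceOf hΦ hx hext, h.iInter_faceOf hΦ hx hext⟩⟩⟩
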